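/- Let $\mathcal{Y}$ be a smooth finite-dimensional Riemannian orbifold, possibly with boundary and possibly ineffective, and let $\mathcal{U}\subseteq \mathcal{Y}\setminus\partial\mathcal{Y}$ be a compact subset (of the underlying space). Then there exist an open neighbourhood $\mathcal{V}$ of $\mathcal{U}$ in $\mathcal{Y}$, a closed orbifold $\mathcal{W}$ (that is, compact and without boundary) of the same dimension, and an open embedding of orbifolds $\mathcal{V}\hookrightarrow\mathcal{W}$. Here an orbifold is presented by a proper étale Lie groupoid, with Hausdorff second countable manifolds of objects and arrows (manifolds with boundary if the orbifold has boundary); its underlying space is the quotient of the objects by the relation of being joined by an arrow. A Riemannian metric on it is a smooth Riemannian metric on the objects that is invariant under the arrows. For open $\mathcal{V}$, the orbifold $\mathcal{V}$ is the full subgroupoid on the objects over $\mathcal{V}$. An open embedding is a smooth functor that is a local diffeomorphism on objects and fully faithful; in particular it induces an open embedding of underlying spaces and isomorphisms of isotropy groups. -/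

import Mathlib

open scoped Manifold ContDiff Topology

universe u v w v' w'

/-- A smooth orbifold modelled on `I`, presented by a proper étale Lie groupoid. The presentation
allows ineffective orbifolds; two presentations define the same orbifold when they are Morita
equivalent. Choosing `I = 𝓡 n` gives orbifolds without boundary, and `I = 𝓡∂ n` gives orbifolds
with boundary. -/
structure Orbifold {E : Type v} [NormedAddCommGroup E] [NormedSpace ℝ E]
    {H : Type w} [TopologicalSpace H] (I : ModelWithCorners ℝ E H) where
  /-- The manifold of objects; its points are the points of the orbifold charts. -/
  Obj : Type u
  /-- The manifold of arrows; an arrow identifies two points of the orbifold charts. -/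
  Arr : Type u
  [topObj : TopologicalSpace Obj]
  [chartedObj : ChartedSpace H Obj]
  [manifoldObj : IsManifold I ∞ Obj]
  [t2Obj : T2Space Obj]
  [secondCountableObj : SecondCountableTopology Obj]
  [topArr : TopologicalSpace Arr]
  [chartedArr : ChartedSpace H Arr]
  [manifoldArr : IsManifold I ∞ Arr]
  [t2Arr : T2Space Arr]
  [secondCountableArr : SecondCountableTopology Arr]
  src : Arr → Obj
  tgt : Arr → Obj
  unit : Obj → Arr
  inv : Arr → Arr
  /-- Composition in diagrammatic order: first `g`, then `h`. -/
  comp : ∀ g h : Arr, tgt g = src h → Arr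
  src_unit : ∀ x, src (unit x) = x
  tgt_unit : ∀ x, tgt (unit x) = x
  src_inv : ∀ g, src (inv g) = tgt g
  tgt_inv : ∀ g, tgt (inv g) = src g
  src_comp : ∀ g h p, src (comp g h p) = src g
  tgt_comp : ∀ g h p, tgt (comp g h p) = tgt h
  unit_comp : ∀ g, comp (unit (src g)) g (tgt_unit _) = g
  comp_unit : ∀ g, comp g (unit (tgt g)) (src_unit _).symm = g
  comp_inv : ∀ g, comp g (inv g) (src_inv g).symm = unit (src g)
  inv_comp : ∀ g, comp (inv g) g (tgt_inv g) = unit (tgt g)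
  assoc : ∀ g h k (p : tgt g = src h) (q : tgt h = src k),
    comp (comp g h p) k ((tgt_comp g h p).trans q) =
      comp g (comp h k q) (p.trans (src_comp h k q).symm)
  /-- The groupoid is étale. -/
  src_localDiffeo : IsLocalDiffeomorph I I ∞ src
  tgt_localDiffeo : IsLocalDiffeomorph I I ∞ tgt
  unit_smooth : ContMDiff I I ∞ unit
  inv_smooth : ContMDiff I I ∞ inv
  /-- Composition is continuous on composable pairs. As `src (comp g h) = src g` and `src` is a
  local diffeomorphism, this is the same as smoothness of composition. -/
  comp_continuous :
    Continuous fun p : {p : Arr × Arr // tgt p.1 = src p.2} => comp p.1.1 p.1.2 p.2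
  /-- The groupoid is proper. -/
  proper : IsProperMap fun g => (src g, tgt g)

namespace Orbifold

attribute [instance] topObj chartedObj manifoldObj t2Obj secondCountableObj
  topArr chartedArr manifoldArr t2Arr secondCountableArr

section Basic

variable {E : Type v} [NormedAddCommGroup E] [NormedSpace ℝ E]
  {H : Type w} [TopologicalSpace H] {I : ModelWithCorners ℝ E H}

/-- Two objects are equivalent when an arrow joins them. -/
def orbitRel (𝒴 : Orbifold.{u} I) : Setoid 𝒴.Obj where
  r x y := ∃ g, 𝒴.src g = x ∧ 𝒴.tgt g = y
  iseqv :=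
    { refl := fun x => ⟨𝒴.unit x, 𝒴.src_unit x, 𝒴.tgt_unit x⟩
      symm := by
        rintro x y ⟨g, rfl, rfl⟩
        exact ⟨𝒴.inv g, 𝒴.src_inv g, 𝒴.tgt_inv g⟩
      trans := by
        rintro x y z ⟨g, rfl, rfl⟩ ⟨h, hs, rfl⟩
        exact ⟨𝒴.comp g h hs.symm, 𝒴.src_comp _ _ _, 𝒴.tgt_comp _ _ _⟩ }

/-- The underlying topological space of the orbifold, with the quotient topology. -/
abbrev Space (𝒴 : Orbifold.{u} I) : Type u := Quotient 𝒴.orbitRel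

/-- The point of the orbifold represented by an object. -/
def pt (𝒴 : Orbifold.{u} I) (x : 𝒴.Obj) : 𝒴.Space := Quotient.mk 𝒴.orbitRel x

theorem continuous_pt (𝒴 : Orbifold.{u} I) : Continuous 𝒴.pt := continuous_quotient_mk'

theorem pt_src (𝒴 : Orbifold.{u} I) (g : 𝒴.Arr) : 𝒴.pt (𝒴.src g) = 𝒴.pt (𝒴.tgt g) :=
  Quotient.sound ⟨g, rfl, rfl⟩

/-- The boundary of an orbifold, as a subset of its underlying space. -/
def boundary (𝒴 : Orbifold.{u} I) : Set 𝒴.Space := 𝒴.pt '' I.boundary 𝒴.Obj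

/-- An orbifold is closed when it is compact and has no boundary. -/
def IsClosedOrbifold (𝒴 : Orbifold.{u} I) : Prop := CompactSpace 𝒴.Space ∧ 𝒴.boundary = ∅

/-- A Riemannian metric on an orbifold: a smooth Riemannian metric on the objects that is invariant
under the arrows, so that it is given by invariant metrics on the charts which agree on overlaps. -/
structure RiemannianMetric (𝒴 : Orbifold.{u} I) where
  metric : Bundle.ContMDiffRiemannianMetric I ∞ E (fun x : 𝒴.Obj => TangentSpace I x)
  invariant : ∀ (g : 𝒴.Arr) (a b : TangentSpace I g),
    metric.inner (𝒴.src g) (mfderiv I I 𝒴.src g a) (mfderiv I I 𝒴.src g b) =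
      metric.inner (𝒴.tgt g) (mfderiv I I 𝒴.tgt g a) (mfderiv I I 𝒴.tgt g b)

end Basic

section Restrict

variable {E : Type v} [NormedAddCommGroup E] [NormedSpace ℝ E]
  {H : Type w} [TopologicalSpace H] {I : ModelWithCorners ℝ E H}

theorem exists_partialDiffeomorph_val {M : Type*} [TopologicalSpace M] [ChartedSpace H M]
    (U : TopologicalSpace.Opens M) (x : U) :
    ∃ Φ : PartialDiffeomorph I I U M ∞, Φ.source = Set.univ ∧ ∀ y, Φ y = y.1 := by
  have : Nonempty U := ⟨x⟩
  let e := U.openPartialHomeomorphSubtypeCoe ⟨x⟩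
  refine ⟨{ toPartialEquiv := e.toPartialEquiv
            open_source := e.open_source
            open_target := e.open_target
            contMDiffOn_toFun := ?_
            contMDiffOn_invFun := ?_ }, ?_, ?_⟩
  · exact contMDiff_subtype_val.contMDiffOn
  · intro y hy
    refine ContMDiffAt.contMDiffWithinAt ?_
    change ContMDiffAt I I ∞ (e.symm : M → U) y
    rw [← ContMDiffAt.subtypeVal_comp_iff]
    refine (contMDiffAt_id (x := y)).congr_of_eventuallyEq ?_
    filter_upwards [e.open_target.mem_nhds hy] with z hz
    exact e.right_inv hz
  · rfl
  · intro y; rfl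

theorem isLocalDiffeomorph_restrict {M N : Type*} [TopologicalSpace M] [ChartedSpace H M]
    [TopologicalSpace N] [ChartedSpace H N] {f : M → N} (hf : IsLocalDiffeomorph I I ∞ f)
    (U : TopologicalSpace.Opens M) (V : TopologicalSpace.Opens N) (h : ∀ x : U, f x ∈ V) :
    IsLocalDiffeomorph I I ∞ (fun x : U => (⟨f x, h x⟩ : V)) := by
  intro x
  obtain ⟨Φ, hΦs, hΦ⟩ := exists_partialDiffeomorph_val (I := I) U x
  obtain ⟨Ψ, hΨs, hΨ⟩ := exists_partialDiffeomorph_val (I := I) V ⟨f x, h x⟩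
  obtain ⟨S, hxS, hS⟩ := hf x.1
  have key : ∀ y : U, Ψ.toPartialEquiv.symm (f y) = ⟨f y, h y⟩ := fun y => by
    have := Ψ.toPartialEquiv.left_inv (x := ⟨f y, h y⟩) (by rw [hΨs]; trivial)
    rwa [hΨ] at this
  have hmem : ∀ y : U, f y ∈ Ψ.target := fun y => by
    have := Ψ.toPartialEquiv.map_source (x := ⟨f y, h y⟩) (by rw [hΨs]; trivial)
    rwa [hΨ] at this
  refine ⟨(Φ.trans S).trans Ψ.symm, ?_, ?_⟩
  · change x ∈ (Φ.source ∩ Φ ⁻¹' S.source) ∩ (fun y => S (Φ y)) ⁻¹' Ψ.target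
    refine ⟨⟨by rw [hΦs]; trivial, ?_⟩, ?_⟩
    · rw [Set.mem_preimage, hΦ]; exact hxS
    · rw [Set.mem_preimage, hΦ, ← hS hxS]; exact hmem x
  · intro y hy
    change y ∈ (Φ.source ∩ Φ ⁻¹' S.source) ∩ (fun y => S (Φ y)) ⁻¹' Ψ.target at hy
    have hyS : y.1 ∈ S.source := by simpa [hΦ] using hy.1.2
    change _ = Ψ.toPartialEquiv.symm (S (Φ y))
    rw [hΦ, ← hS hyS, key]

variable (𝒴 : Orbifold.{u} I) (V : TopologicalSpace.Opens 𝒴.Space)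

/-- The objects lying over an open subset of the underlying space. -/
def objOver : TopologicalSpace.Opens 𝒴.Obj := ⟨𝒴.pt ⁻¹' V, V.isOpen.preimage 𝒴.continuous_pt⟩

/-- The arrows lying over an open subset of the underlying space. -/
def arrOver : TopologicalSpace.Opens 𝒴.Arr :=
  ⟨𝒴.src ⁻¹' 𝒴.objOver V,
    (𝒴.objOver V).isOpen.preimage 𝒴.src_localDiffeo.contMDiff.continuous⟩

theorem tgt_mem_objOver (g : 𝒴.arrOver V) : 𝒴.tgt g ∈ 𝒴.objOver V := by
  have h : 𝒴.pt (𝒴.src g) ∈ V := g.2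
  rw [pt_src] at h
  exact h

/-- The open sub-orbifold with underlying space `V`: the full subgroupoid on the objects
over `V`. -/
noncomputable def restrict : Orbifold.{u} I where
  Obj := 𝒴.objOver V
  Arr := 𝒴.arrOver V
  src g := ⟨𝒴.src g, g.2⟩
  tgt g := ⟨𝒴.tgt g, 𝒴.tgt_mem_objOver V g⟩
  unit x := ⟨𝒴.unit x, by
    change 𝒴.src (𝒴.unit x) ∈ 𝒴.objOver V
    rw [𝒴.src_unit]; exact x.2⟩
  inv g := ⟨𝒴.inv g, by
    change 𝒴.src (𝒴.inv g) ∈ 𝒴.objOver V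
    rw [𝒴.src_inv]; exact 𝒴.tgt_mem_objOver V g⟩
  comp g h p := ⟨𝒴.comp g h (congrArg Subtype.val p), by
    change 𝒴.src (𝒴.comp g h _) ∈ 𝒴.objOver V
    rw [𝒴.src_comp]; exact g.2⟩
  src_unit x := Subtype.ext (𝒴.src_unit x)
  tgt_unit x := Subtype.ext (𝒴.tgt_unit x)
  src_inv g := Subtype.ext (𝒴.src_inv g)
  tgt_inv g := Subtype.ext (𝒴.tgt_inv g)
  src_comp g h p := Subtype.ext (𝒴.src_comp g h _)
  tgt_comp g h p := Subtype.ext (𝒴.tgt_comp g h _)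
  unit_comp g := Subtype.ext (𝒴.unit_comp g)
  comp_unit g := Subtype.ext (𝒴.comp_unit g)
  comp_inv g := Subtype.ext (𝒴.comp_inv g)
  inv_comp g := Subtype.ext (𝒴.inv_comp g)
  assoc g h k p q := Subtype.ext (𝒴.assoc g h k _ _)
  src_localDiffeo := isLocalDiffeomorph_restrict 𝒴.src_localDiffeo (𝒴.arrOver V) (𝒴.objOver V) _
  tgt_localDiffeo := isLocalDiffeomorph_restrict 𝒴.tgt_localDiffeo (𝒴.arrOver V) (𝒴.objOver V) _
  unit_smooth := by
    rw [← ContMDiff.subtypeVal_comp_iff]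
    exact 𝒴.unit_smooth.comp contMDiff_subtype_val
  inv_smooth := by
    rw [← ContMDiff.subtypeVal_comp_iff]
    exact 𝒴.inv_smooth.comp contMDiff_subtype_val
  comp_continuous := by
    refine Continuous.subtype_mk ?_ _
    refine 𝒴.comp_continuous.comp (f := fun p : {p : 𝒴.arrOver V × 𝒴.arrOver V //
      (⟨𝒴.tgt p.1, 𝒴.tgt_mem_objOver V p.1⟩ : 𝒴.objOver V) = ⟨𝒴.src p.2, p.2.2⟩} =>
      (⟨(p.1.1.1, p.1.2.1), congrArg Subtype.val p.2⟩ :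
        {p : 𝒴.Arr × 𝒴.Arr // 𝒴.tgt p.1 = 𝒴.src p.2})) ?_
    refine Continuous.subtype_mk ?_ _
    fun_prop
  proper := by
    have hs : Continuous 𝒴.src := 𝒴.src_localDiffeo.contMDiff.continuous
    have ht : Continuous 𝒴.tgt := 𝒴.tgt_localDiffeo.contMDiff.continuous
    rw [isProperMap_iff_ultrafilter]
    refine ⟨by fun_prop, ?_⟩
    rintro F ⟨x, y⟩ hF
    have hF' : Filter.Tendsto (fun g : 𝒴.Arr => (𝒴.src g, 𝒴.tgt g))
        (F.map (Subtype.val : 𝒴.arrOver V → 𝒴.Arr)) (𝓝 (x.1, y.1)) := by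
      have hc : Continuous fun p : 𝒴.objOver V × 𝒴.objOver V => (p.1.1, p.2.1) := by fun_prop
      exact (hc.tendsto (x, y)).comp hF
    obtain ⟨g, hg, hFg⟩ := (isProperMap_iff_ultrafilter.1 𝒴.proper).2 hF'
    have hgs : 𝒴.src g = x.1 := congrArg Prod.fst hg
    have hgt : 𝒴.tgt g = y.1 := congrArg Prod.snd hg
    refine ⟨⟨g, ?_⟩, ?_, ?_⟩
    · change 𝒴.src g ∈ 𝒴.objOver V
      rw [hgs]; exact x.2
    · exact Prod.ext (Subtype.ext hgs) (Subtype.ext hgt)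
    · rw [nhds_subtype, ← Filter.map_le_iff_le_comap]
      exact hFg

end Restrict

/-- An open embedding of orbifolds, as a morphism of the presenting groupoids: a smooth functor
that is a local diffeomorphism on objects and fully faithful. Such a functor identifies the first
orbifold with an open sub-orbifold of the second; in particular it is an open embedding of the
underlying spaces and an isomorphism on all isotropy groups. -/
structure OpenEmbedding {E : Type v} [NormedAddCommGroup E] [NormedSpace ℝ E]
    {H : Type w} [TopologicalSpace H] {I : ModelWithCorners ℝ E H}
    {E' : Type v'} [NormedAddCommGroup E'] [NormedSpace ℝ E']
    {H' : Type w'} [TopologicalSpace H'] {J : ModelWithCorners ℝ E' H'}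
    (𝒳 : Orbifold.{u} I) (𝒲 : Orbifold.{u} J) where
  obj : 𝒳.Obj → 𝒲.Obj
  arr : 𝒳.Arr → 𝒲.Arr
  src_arr : ∀ g, 𝒲.src (arr g) = obj (𝒳.src g)
  tgt_arr : ∀ g, 𝒲.tgt (arr g) = obj (𝒳.tgt g)
  arr_unit : ∀ x, arr (𝒳.unit x) = 𝒲.unit (obj x)
  arr_comp : ∀ g h (p : 𝒳.tgt g = 𝒳.src h),
    arr (𝒳.comp g h p) =
      𝒲.comp (arr g) (arr h) ((tgt_arr g).trans ((congrArg obj p).trans (src_arr h).symm))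
  obj_localDiffeo : IsLocalDiffeomorph I J ∞ obj
  arr_smooth : ContMDiff I J ∞ arr
  fullyFaithful : ∀ (x y : 𝒳.Obj) (k : 𝒲.Arr), 𝒲.src k = obj x → 𝒲.tgt k = obj y →
    ∃! g : 𝒳.Arr, 𝒳.src g = x ∧ 𝒳.tgt g = y ∧ arr g = k

end Orbifold

/-! A neighbourhood of `U` embeds in the double of a compact domain cut out by a regular level of an
invariant function. Take a smooth compactly supported `h ≥ 0` on objects, nonzero only where
boundaryless charts exist and positive somewhere on each orbit over `U`. Summing `h` over the
targets of the arrows out of `x` gives `ρ = orbitSum h`. Properness and étaleness make the sum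
finite and `ρ` smooth (`contMDiff_orbitSum`); translation by arrows makes it invariant
(`orbitSum_src_eq`). On the compact set `U` it is at least some `δ > 0`, and Sard's theorem
(`volume_critical_values`) gives a regular value `c` in `(0, δ)`.

Gluing two copies of `{ρ ≥ c}` would call for a collar. The double is instead the hypersurface `ρ(x)
- t² = c` in `Obj × ℝ`. The derivative in `t` is nonzero off `t = 0`, and regularity of `c` takes
care of `t = 0`, so this is a boundaryless manifold of the same dimension (`exists_mem_charts`). The
same equation over `Arr` gives the arrows, which leave `t` fixed. Every orbit in `{ρ ≥ c}` meets the
support of `h`, so the quotient is compact. The graph `t = √(ρ - c)` embeds `{ρ > c}`, which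
contains `U`.

Sard's theorem for real-valued functions is proved by stratifying the critical points by order of
vanishing. Where enough derivatives vanish, a Hölder estimate bounds the Hausdorff dimension of the
image; each other stratum lies locally in a hypersurface, and induction on dimension applies. -/

/-! ### Straightening a function at a noncritical point -/

section Straightening

/-- A smooth function is, near a point where its derivative does not vanish, the last coordinate of
a smooth coordinate system. -/
theorem exists_straightening {E : Type*} [NormedAddCommGroup E] [NormedSpace ℝ E]
    [FiniteDimensional ℝ E] {E₀ : Type*} [NormedAddCommGroup E₀] [NormedSpace ℝ E₀]
    [FiniteDimensional ℝ E₀] (hdim : Module.finrank ℝ E₀ + 1 = Module.finrank ℝ E)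
    {F : E → ℝ} {O : Set E} (hO : IsOpen O) (hF : ContDiffOn ℝ ∞ F O) {p : E} (hp : p ∈ O)
    (hd : fderiv ℝ F p ≠ 0) :
    ∃ θ : OpenPartialHomeomorph E (E₀ × ℝ), p ∈ θ.source ∧ θ.source ⊆ O ∧
      ContDiffOn ℝ ∞ θ θ.source ∧ ContDiffOn ℝ ∞ θ.symm θ.target ∧
      ∀ q ∈ θ.source, (θ q).2 = F q := by
  set L := fderiv ℝ F p with hL
  have hLsurj : Function.Surjective L.toLinearMap := by
    apply LinearMap.surjective
    intro h; exact hd (ContinuousLinearMap.coe_injective h)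
  have hker : Module.finrank ℝ (LinearMap.ker L.toLinearMap) = Module.finrank ℝ E₀ := by
    have h1 := LinearMap.finrank_range_add_finrank_ker L.toLinearMap
    rw [LinearMap.range_eq_top.2 hLsurj, finrank_top, Module.finrank_self] at h1
    omega
  obtain ⟨π, hπ⟩ := LinearMap.exists_leftInverse_of_injective
    (LinearMap.ker L.toLinearMap).subtype (Submodule.ker_subtype _)
  let κ : LinearMap.ker L.toLinearMap ≃ₗ[ℝ] E₀ := LinearEquiv.ofFinrankEq _ _ hker
  -- A projection `π` onto the kernel of `L`, paired with `L` itself, is an isomorphism; replacing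
  -- `L` by `F` keeps the derivative at `p`.
  let A₀ : E →ₗ[ℝ] E₀ × ℝ := (κ.toLinearMap ∘ₗ π).prod L.toLinearMap
  have hA₀ : Function.Injective A₀ := by
    rw [injective_iff_map_eq_zero]
    intro x hx
    have h2 : L x = 0 := congrArg Prod.snd hx
    have h1 : κ (π x) = 0 := congrArg Prod.fst hx
    have h3 : π x = 0 := by simpa using h1
    have h4 : π x = ⟨x, h2⟩ := LinearMap.congr_fun hπ ⟨x, h2⟩
    rw [h3] at h4
    exact (congrArg Subtype.val h4).symm
  let A : E ≃L[ℝ] E₀ × ℝ := (LinearEquiv.ofInjectiveOfFinrankEq A₀ hA₀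
    (by rw [Module.finrank_prod, Module.finrank_self, hdim])).toContinuousLinearEquiv
  have hA2 : ∀ x, (A x).2 = L x := fun x => rfl
  let G : E → E₀ × ℝ := fun q => ((A q).1, F q)
  have hG : ContDiffOn ℝ ∞ G O := by
    refine ContDiffOn.prodMk ?_ hF
    exact (contDiff_fst.comp A.contDiff).contDiffOn
  have hGat : ∀ q ∈ O, ContDiffAt ℝ ∞ G q := fun q hq => hG.contDiffAt (hO.mem_nhds hq)
  have hFp : HasFDerivAt F L p :=
    ((hF.contDiffAt (hO.mem_nhds hp)).differentiableAt (by simp)).hasFDerivAt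
  have hGp : HasFDerivAt G (A : E →L[ℝ] E₀ × ℝ) p := by
    have h1 : HasFDerivAt (fun q => (A q).1)
        ((ContinuousLinearMap.fst ℝ E₀ ℝ).comp (A : E →L[ℝ] E₀ × ℝ)) p :=
      ((ContinuousLinearMap.fst ℝ E₀ ℝ).comp (A : E →L[ℝ] E₀ × ℝ)).hasFDerivAt
    exact h1.prodMk hFp
  let θ₀ := (hGat p hp).toOpenPartialHomeomorph G hGp (by simp)
  have hθ₀ : ∀ q, θ₀ q = G q := fun q => rfl
  -- Restricting to points where the derivative of `G` is invertible makes the inverse smooth on the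
  -- whole target, not only near the image of `p`.
  let O' : Set E := O ∩ fderiv ℝ G ⁻¹' Set.range ((↑) : (E ≃L[ℝ] E₀ × ℝ) → E →L[ℝ] E₀ × ℝ)
  have hO' : IsOpen O' := (hG.continuousOn_fderiv_of_isOpen hO (by simp)).isOpen_inter_preimage hO
    ContinuousLinearEquiv.isOpen
  refine ⟨θ₀.restrOpen O' hO', ?_, ?_, ?_, ?_, ?_⟩
  · refine ⟨(hGat p hp).mem_toOpenPartialHomeomorph_source hGp (by simp), hp, ?_⟩
    rw [Set.mem_preimage, hGp.fderiv]
    exact ⟨A, rfl⟩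
  · exact fun q hq => hq.2.1
  · exact hG.mono fun q hq => hq.2.1
  · intro w hw
    have hw' := (θ₀.restrOpen O' hO').map_target hw
    obtain ⟨B, hB⟩ := hw'.2.2
    refine ((θ₀.restrOpen O' hO').contDiffAt_symm (f₀' := B) hw ?_ (hGat _ hw'.2.1)
      ).contDiffWithinAt
    rw [hB]
    exact ((hGat _ hw'.2.1).differentiableAt (by simp)).hasFDerivAt
  · intro q hq; rfl

end Straightening

/-! ### Sard's theorem for real-valued functions -/

section Sard

variable {E : Type v} [NormedAddCommGroup E] [NormedSpace ℝ E]

theorem measure_image_null_of_locally_null {X : Type*} [TopologicalSpace X]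
    [SecondCountableTopology X] (f : X → ℝ) (S : Set X)
    (h : ∀ x ∈ S, ∃ N ∈ 𝓝 x, MeasureTheory.volume (f '' (S ∩ N)) = 0) :
    MeasureTheory.volume (f '' S) = 0 := by
  choose! N hN hN0 using h
  obtain ⟨T, hTS, hTc, hT⟩ := TopologicalSpace.countable_cover_nhdsWithin
    (s := S) (f := N) (fun x hx => mem_nhdsWithin_of_mem_nhds (hN x hx))
  refine MeasureTheory.measure_mono_null (t := ⋃ x ∈ T, f '' (S ∩ N x)) ?_ ?_
  · rintro _ ⟨y, hy, rfl⟩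
    obtain ⟨x, hx, hyx⟩ := Set.mem_iUnion₂.1 (hT hy)
    exact Set.mem_iUnion₂.2 ⟨x, hx, y, ⟨hy, hyx⟩, rfl⟩
  · exact (MeasureTheory.measure_biUnion_null_iff hTc).2 fun x hx => hN0 x (hTS hx)

theorem infty_add_natCast_le (k : ℕ) : (∞ : WithTop ℕ∞) + k ≤ ∞ := by
  exact_mod_cast le_top (a := (⊤ : ℕ∞) + k)

theorem ContDiffOn.iteratedFDeriv_of_isOpen {F : Type*} [NormedAddCommGroup F] [NormedSpace ℝ F]
    {f : E → F} {O : Set E} (hO : IsOpen O)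
    (hf : ContDiffOn ℝ ∞ f O) (k : ℕ) : ContDiffOn ℝ ∞ (iteratedFDeriv ℝ k f) O := fun _ hx =>
  ((hf.contDiffAt (hO.mem_nhds hx)).iteratedFDeriv_right (i := k) (m := ∞)
    (infty_add_natCast_le k)).contDiffWithinAt

/-- If the derivatives of `f` of orders `1, …, n` vanish at `y`, then `f z - f y` is of
order `‖z - y‖ ^ (n + 1)`. -/
theorem norm_sub_le_of_iteratedFDeriv_eq_zero {f : E → ℝ} {s : Set E}
    (hs : Convex ℝ s) (hf : ∀ x ∈ s, ContDiffAt ℝ ∞ f x) {n : ℕ} {M : ℝ}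
    (hM : ∀ x ∈ s, ‖iteratedFDeriv ℝ (n + 1) f x‖ ≤ M) {y : E} (hy : y ∈ s)
    (h0 : ∀ j, 1 ≤ j → j ≤ n → iteratedFDeriv ℝ j f y = 0) {z : E} (hz : z ∈ s) :
    ‖f z - f y‖ ≤ M * ‖z - y‖ ^ (n + 1) := by
  have hM0 : 0 ≤ M := (norm_nonneg _).trans (hM y hy)
  -- Descends from the derivative of order `n` to order `0`. Each step is the mean value inequality
  -- on the segment from `y` to `z`, where the previous bound is largest at `z`; the vanishing at
  -- `y` turns that bound on a difference into a bound on the derivative.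
  have key : ∀ j k, j + k = n → ∀ z ∈ s,
      ‖iteratedFDeriv ℝ k f z - iteratedFDeriv ℝ k f y‖ ≤ M * ‖z - y‖ ^ (j + 1) := by
    intro j
    induction j with
    | zero =>
      intro k hk z hz
      obtain rfl : k = n := by omega
      have := hs.norm_image_sub_le_of_norm_fderiv_le (𝕜 := ℝ) (f := iteratedFDeriv ℝ k f) (C := M)
        (fun x hx => ((hf x hx).iteratedFDeriv_right (i := k) (m := ∞)
          (infty_add_natCast_le k)).differentiableAt (by simp)) (fun x hx => by
            rw [norm_fderiv_iteratedFDeriv]; exact hM x hx) hy hz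
      simpa using this
    | succ j ih =>
      intro k hk z hz
      have hseg : segment ℝ y z ⊆ s := hs.segment_subset hy hz
      have := (convex_segment y z).norm_image_sub_le_of_norm_fderiv_le (𝕜 := ℝ)
        (f := iteratedFDeriv ℝ k f) (C := M * ‖z - y‖ ^ (j + 1))
        (fun x hx => ((hf x (hseg hx)).iteratedFDeriv_right (i := k) (m := ∞)
          (infty_add_natCast_le k)).differentiableAt (by simp)) ?_ (left_mem_segment ℝ y z)
          (right_mem_segment ℝ y z)
      · rwa [mul_assoc, ← pow_succ] at this
      · intro x hx
        rw [norm_fderiv_iteratedFDeriv]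
        have h1 := ih (k + 1) (by omega) x (hseg hx)
        rw [h0 (k + 1) (by omega) (by omega), sub_zero] at h1
        refine h1.trans ?_
        gcongr
        obtain ⟨t, ht, rfl⟩ := (segment_eq_image_lineMap ℝ y z ▸ hx : x ∈ _)
        rw [AffineMap.lineMap_apply, vsub_eq_sub, vadd_eq_add, add_sub_cancel_right, norm_smul,
          Real.norm_of_nonneg ht.1]
        exact mul_le_of_le_one_left (norm_nonneg _) ht.2
  have h1 := key n 0 (by omega) z hz
  convert h1 using 1
  rw [iteratedFDeriv_zero_eq_comp]
  simp only [Function.comp_apply, ← map_sub, LinearIsometryEquiv.norm_map]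

variable [FiniteDimensional ℝ E]

/-- Taylor's estimate makes `f` locally Hölder of exponent `n + 1` on the flat set, so the image has
Hausdorff dimension at most `n / (n + 1) < 1`. -/
theorem volume_image_null_of_flat {f : E → ℝ} {O : Set E} (hO : IsOpen O)
    (hf : ContDiffOn ℝ ∞ f O) :
    MeasureTheory.volume (f '' {x ∈ O | ∀ j, 1 ≤ j → j ≤ Module.finrank ℝ E →
      iteratedFDeriv ℝ j f x = 0}) = 0 := by
  set n := Module.finrank ℝ E with hn
  have : ProperSpace E := FiniteDimensional.proper_real E
  refine measure_image_null_of_locally_null f _ fun x hx => ?_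
  have hcont := (hf.iteratedFDeriv_of_isOpen hO (n + 1)).continuousOn
  have hev : ∀ᶠ y in 𝓝 x, y ∈ O ∧
      ‖iteratedFDeriv ℝ (n + 1) f y‖ < ‖iteratedFDeriv ℝ (n + 1) f x‖ + 1 := by
    have hxO : ∀ᶠ y in 𝓝 x, y ∈ O := hO.mem_nhds hx.1
    refine hxO.and ?_
    exact (hcont.continuousAt (hO.mem_nhds hx.1)).norm.eventually_lt_const (by linarith)
  obtain ⟨r, hr, hball⟩ := Metric.eventually_nhds_iff_ball.1 hev
  set M := ‖iteratedFDeriv ℝ (n + 1) f x‖ + 1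
  have hM0 : 0 ≤ M := by positivity
  refine ⟨Metric.ball x r, Metric.ball_mem_nhds x hr, ?_⟩
  set T := {x ∈ O | ∀ j, 1 ≤ j → j ≤ n → iteratedFDeriv ℝ j f x = 0} ∩ Metric.ball x r
  have hhol : HolderOnWith (NNReal.mk M hM0) (n + 1 : NNReal) f T := by
    intro z hz y hy
    have h1 := norm_sub_le_of_iteratedFDeriv_eq_zero (convex_ball x r)
      (fun u hu => hf.contDiffAt (hO.mem_nhds (hball u hu).1)) (fun u hu => (hball u hu).2.le)
      hy.2 hy.1.2 hz.2
    rw [edist_dist, edist_dist, dist_eq_norm, dist_eq_norm]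
    have h2 : (ENNReal.ofReal ‖z - y‖) ^ (((n + 1 : NNReal)) : ℝ) =
        ENNReal.ofReal (‖z - y‖ ^ (n + 1)) := by
      rw [ENNReal.ofReal_pow (norm_nonneg _), ← ENNReal.rpow_natCast]
      push_cast; rfl
    rw [h2]
    have h3 : ((NNReal.mk M hM0 : NNReal) : ENNReal) = ENNReal.ofReal M := by
      rw [ENNReal.ofReal, Real.toNNReal_of_nonneg hM0]
    rw [h3, ← ENNReal.ofReal_mul hM0]
    exact ENNReal.ofReal_le_ofReal h1
  have hdim : dimH (f '' T) < ((1 : NNReal) : ENNReal) := by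
    refine (hhol.dimH_image_le (by positivity)).trans_lt ?_
    have h1 : dimH T ≤ n := (dimH_mono (Set.subset_univ T)).trans
      (Real.dimH_univ_eq_finrank E).le
    refine (ENNReal.div_le_div_right h1 _).trans_lt ?_
    rw [ENNReal.div_lt_iff (by simp) (by simp)]
    push_cast
    rw [one_mul]
    exact_mod_cast Nat.lt_succ_self n
  have h0 := hausdorffMeasure_of_dimH_lt hdim
  rw [NNReal.coe_one, MeasureTheory.hausdorffMeasure_real] at h0
  exact h0

/-- Induction on dimension. A critical point that is not flat has a first nonvanishing derivative of
some order `k + 2`. Some component of the derivative of order `k + 1` then has zero set a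
hypersurface near it, containing the nearby stratum, and points of the stratum stay critical for the
restriction of `f`. -/
theorem volume_image_critical_aux (n : ℕ) : ∀ (E : Type v) [NormedAddCommGroup E]
    [NormedSpace ℝ E] [FiniteDimensional ℝ E], Module.finrank ℝ E = n → ∀ (f : E → ℝ) (O : Set E),
    IsOpen O → ContDiffOn ℝ ∞ f O →
    MeasureTheory.volume (f '' {x ∈ O | fderiv ℝ f x = 0}) = 0 := by
  induction n with
  | zero =>
    intro E _ _ _ hE f O hO hf
    refine MeasureTheory.measure_mono_null (Set.image_mono ?_) (volume_image_null_of_flat hO hf)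
    exact fun x hx => ⟨hx.1, fun j h1 h2 => by omega⟩
  | succ n ih =>
    intro E _ _ _ hE f O hO hf
    let A : ℕ → Set E := fun k => {x ∈ O | ∀ j, 1 ≤ j → j ≤ k → iteratedFDeriv ℝ j f x = 0}
    have hA1 : ∀ k, ∀ x ∈ A (k + 1), fderiv ℝ f x = 0 := fun k x hx => by
      have h1 := hx.2 1 le_rfl (by omega)
      rw [← norm_eq_zero, ← norm_iteratedFDeriv_one, h1, norm_zero]
    -- A critical point either leaves the decreasing sequence `A 1, A 2, …` at some stage or lies in
    -- all of them, in particular in the flat set.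
    have hcover : {x ∈ O | fderiv ℝ f x = 0} ⊆
        A (Module.finrank ℝ E) ∪ ⋃ k, (A (k + 1) \ A (k + 2)) := by
      intro x hx
      have hx1 : x ∈ A 1 := ⟨hx.1, fun j h1 h2 => by
        obtain rfl : j = 1 := by omega
        rw [← norm_eq_zero, norm_iteratedFDeriv_one, hx.2, norm_zero]⟩
      by_contra hcon
      rw [Set.mem_union, Set.mem_iUnion, not_or, not_exists] at hcon
      have : ∀ k, x ∈ A (k + 1) := fun k => by
        induction k with
        | zero => exact hx1
        | succ k ihk =>
          by_contra h
          exact hcon.2 k ⟨ihk, h⟩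
      exact hcon.1 (hE ▸ this n)
    refine MeasureTheory.measure_mono_null (Set.image_mono hcover) ?_
    rw [Set.image_union, Set.image_iUnion, MeasureTheory.measure_union_null_iff,
      MeasureTheory.measure_iUnion_null_iff]
    refine ⟨volume_image_null_of_flat hO hf, fun k => ?_⟩
    have : ProperSpace E := FiniteDimensional.proper_real E
    refine measure_image_null_of_locally_null f _ fun x hx => ?_
    have hxO : x ∈ O := hx.1.1
    have hD := hf.iteratedFDeriv_of_isOpen hO (k + 1)
    have hne : iteratedFDeriv ℝ (k + 2) f x ≠ 0 := by
      intro h0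
      refine hx.2 ⟨hxO, fun j h1 h2 => ?_⟩
      rcases Nat.lt_or_ge j (k + 2) with h | h
      · exact hx.1.2 j h1 (by omega)
      · obtain rfl : j = k + 2 := by omega
        exact h0
    have hne' : fderiv ℝ (iteratedFDeriv ℝ (k + 1) f) x ≠ 0 := by
      intro h
      refine hne (norm_eq_zero.1 ?_)
      rw [← norm_fderiv_iteratedFDeriv, h]
      exact ContinuousLinearMap.opNorm_zero
    -- Evaluation at a fixed `m` turns the multilinear-valued derivative into a scalar function to
    -- which straightening applies.
    obtain ⟨m, hm⟩ : ∃ m : Fin (k + 1) → E,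
        fderiv ℝ (fun y => iteratedFDeriv ℝ (k + 1) f y m) x ≠ 0 := by
      by_contra! hcon
      refine hne' (ContinuousLinearMap.ext fun v => ContinuousMultilinearMap.ext fun m => ?_)
      have h1 := (((hD.contDiffAt (hO.mem_nhds hxO)).differentiableAt
        (by simp)).hasFDerivAt.continuousMultilinear_apply_const m).fderiv
      rw [hcon m] at h1
      exact (congrArg (fun T : E →L[ℝ] ℝ => T v) h1).symm
    have hw : ContDiffOn ℝ ∞ (fun y => iteratedFDeriv ℝ (k + 1) f y m) O :=
      (ContinuousMultilinearMap.apply ℝ (fun _ : Fin (k + 1) => E) ℝ m).contDiff.comp_contDiffOn hD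
    -- Serves only as a model space of dimension one less in the same universe.
    let E₀ := LinearMap.ker (fderiv ℝ (fun y => iteratedFDeriv ℝ (k + 1) f y m) x).toLinearMap
    have hE₀ : Module.finrank ℝ E₀ + 1 = Module.finrank ℝ E := by
      have hsurj : Function.Surjective
          (fderiv ℝ (fun y => iteratedFDeriv ℝ (k + 1) f y m) x).toLinearMap :=
        LinearMap.surjective fun h => hm (ContinuousLinearMap.coe_injective h)
      have h1 := LinearMap.finrank_range_add_finrank_ker
        (fderiv ℝ (fun y => iteratedFDeriv ℝ (k + 1) f y m) x).toLinearMap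
      rw [LinearMap.range_eq_top.2 hsurj, finrank_top, Module.finrank_self] at h1
      exact (add_comm _ _).trans h1
    obtain ⟨θ, hxθ, hθO, hθ, hθs, hθ2⟩ := exists_straightening (E₀ := E₀) hE₀ hO hw hxO hm
    let Q : Set E₀ := {u | (u, (0 : ℝ)) ∈ θ.target}
    have hQ : IsOpen Q := θ.open_target.preimage (by fun_prop)
    -- Parametrises the zero set of the chosen component inside `θ.source`.
    let j : E₀ → E := fun u => θ.symm (u, 0)
    have hj : ContDiffOn ℝ ∞ j Q :=
      hθs.comp ((contDiff_id.prodMk contDiff_const).contDiffOn) fun u hu => hu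
    have hjO : ∀ u ∈ Q, j u ∈ O := fun u hu => hθO (θ.map_target hu)
    have hnull := ih E₀ (by omega) (f ∘ j) Q hQ (hf.comp hj hjO)
    refine ⟨θ.source, θ.open_source.mem_nhds hxθ, MeasureTheory.measure_mono_null ?_ hnull⟩
    rintro _ ⟨y, ⟨⟨hyA, -⟩, hyθ⟩, rfl⟩
    have hy0 : (θ y).2 = 0 := by
      rw [hθ2 y hyθ, hyA.2 (k + 1) (by omega) le_rfl]; rfl
    have hθy : ((θ y).1, (0 : ℝ)) = θ y := Prod.ext rfl hy0.symm
    have hjy : j (θ y).1 = y := by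
      change θ.symm ((θ y).1, 0) = y
      rw [hθy, θ.left_inv hyθ]
    have hyQ : (θ y).1 ∈ Q := by
      change ((θ y).1, (0 : ℝ)) ∈ θ.target
      rw [hθy]; exact θ.map_source hyθ
    refine ⟨(θ y).1, ⟨hyQ, ?_⟩, congrArg f hjy⟩
    have hfy : HasFDerivAt f (0 : E →L[ℝ] ℝ) (j (θ y).1) := by
      rw [hjy, ← hA1 k y hyA]
      exact ((hf.contDiffAt (hO.mem_nhds hyA.1)).differentiableAt (by simp)).hasFDerivAt
    have := hfy.comp (θ y).1
      ((hj.contDiffAt (hQ.mem_nhds hyQ)).differentiableAt (by simp)).hasFDerivAt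
    rw [this.fderiv, ContinuousLinearMap.zero_comp]

/-- **Sard's theorem** for real-valued functions. -/
theorem volume_image_critical {f : E → ℝ} {O : Set E} (hO : IsOpen O) (hf : ContDiffOn ℝ ∞ f O) :
    MeasureTheory.volume (f '' {x ∈ O | fderiv ℝ f x = 0}) = 0 :=
  volume_image_critical_aux _ E rfl f O hO hf

end Sard

/-! ### The double of a superlevel set as a hypersurface -/

section LevelDouble

variable {E : Type v} [NormedAddCommGroup E] [NormedSpace ℝ E]
  {H : Type w} [TopologicalSpace H] {I : ModelWithCorners ℝ E H}
  {M : Type u} [TopologicalSpace M] [ChartedSpace H M]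
  {M' : Type u} [TopologicalSpace M'] [ChartedSpace H M']

variable (I M) in
/-- A smooth function on `M` together with a regular value, such that the corresponding closed
superlevel set consists of interior points. -/
structure RegularLevel where
  fn : M → ℝ
  level : ℝ
  smooth : ContMDiff I 𝓘(ℝ, ℝ) ∞ fn
  exists_chart : ∀ x, level ≤ fn x → ∃ Φ : PartialDiffeomorph I 𝓘(ℝ, E) M E ∞, x ∈ Φ.source
  regular : ∀ x, fn x = level → ∃ Φ : PartialDiffeomorph I 𝓘(ℝ, E) M E ∞,
    x ∈ Φ.source ∧ fderiv ℝ (fn ∘ Φ.symm) (Φ x) ≠ 0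

namespace RegularLevel

variable (D : RegularLevel I M) (D' : RegularLevel I M')

/-- The double of the closed superlevel set of a regular value, realised as a hypersurface in
`M × ℝ`. -/
def Double : Type u := {p : M × ℝ // D.fn p.1 - p.2 ^ 2 = D.level}

variable {D} {D'}

namespace Double

instance : TopologicalSpace D.Double := inferInstanceAs (TopologicalSpace (Subtype _))

instance [T2Space M] : T2Space D.Double := inferInstanceAs (T2Space (Subtype _))

instance [SecondCountableTopology M] : SecondCountableTopology D.Double :=
  Topology.IsInducing.subtypeVal.secondCountableTopology

/-- The point of the double with the given coordinates. -/
def mk (p : M × ℝ) (h : D.fn p.1 - p.2 ^ 2 = D.level) : D.Double := ⟨p, h⟩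

/-- The point of `M` under a point of the double. -/
def base (z : D.Double) : M := z.1.1

/-- The transverse coordinate of a point of the double. -/
def height (z : D.Double) : ℝ := z.1.2

theorem eq_level (z : D.Double) : D.fn z.base - z.height ^ 2 = D.level := z.2

theorem ext {z z' : D.Double} (h : z.base = z'.base) (h' : z.height = z'.height) : z = z' :=
  Subtype.ext (Prod.ext h h')

theorem continuous_base : Continuous (base : D.Double → M) :=
  continuous_fst.comp continuous_subtype_val

theorem continuous_height : Continuous (height : D.Double → ℝ) :=
  continuous_snd.comp continuous_subtype_val

theorem isEmbedding_coord :
    Topology.IsEmbedding fun z : D.Double => ((z.base, z.height) : M × ℝ) :=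
  Topology.IsEmbedding.subtypeVal

theorem isClosedEmbedding_coord :
    Topology.IsClosedEmbedding fun z : D.Double => ((z.base, z.height) : M × ℝ) :=
  (isClosed_eq ((D.smooth.continuous.comp continuous_fst).sub (continuous_snd.pow 2))
    continuous_const : IsClosed {p : M × ℝ | D.fn p.1 - p.2 ^ 2 = D.level}
    ).isClosedEmbedding_subtypeVal

theorem tendsto_nhds_of_coord {ι : Type*} {l : Filter ι} {h : ι → D.Double} {z : D.Double}
    (h₁ : Filter.Tendsto (fun i => (h i).base) l (𝓝 z.base))
    (h₂ : Filter.Tendsto (fun i => (h i).height) l (𝓝 z.height)) : Filter.Tendsto h l (𝓝 z) :=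
  isEmbedding_coord.isInducing.tendsto_nhds_iff.2 (h₁.prodMk_nhds h₂)

theorem continuousWithinAt_of_coord {N : Type*} [TopologicalSpace N] {h : N → D.Double} {s : Set N}
    {n : N} (h₁ : ContinuousWithinAt (fun n => (h n).base) s n)
    (h₂ : ContinuousWithinAt (fun n => (h n).height) s n) : ContinuousWithinAt h s n :=
  tendsto_nhds_of_coord h₁ h₂

open Classical in
/-- The point of the double with the given coordinates, or a default point if there is none. -/
noncomputable def mkD (z₀ : D.Double) (p : M × ℝ) : D.Double :=
  if h : D.fn p.1 - p.2 ^ 2 = D.level then mk p h else z₀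

theorem base_mkD {z₀ : D.Double} {p : M × ℝ} (h : D.fn p.1 - p.2 ^ 2 = D.level) :
    (mkD z₀ p).base = p.1 := by
  rw [mkD, dif_pos h]; rfl

theorem height_mkD {z₀ : D.Double} {p : M × ℝ} (h : D.fn p.1 - p.2 ^ 2 = D.level) :
    (mkD z₀ p).height = p.2 := by
  rw [mkD, dif_pos h]; rfl

theorem mkD_coord (z₀ z : D.Double) : mkD z₀ (z.base, z.height) = z :=
  ext (base_mkD z.eq_level) (height_mkD z.eq_level)

variable (D) in
/-- The charts of the double: smooth parametrisations whose inverses extend smoothly to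
`M × ℝ`. -/
def charts : Set (OpenPartialHomeomorph D.Double E) :=
  {e | ContMDiffOn 𝓘(ℝ, E) I ∞ (fun w => (e.symm w).base) e.target ∧
    ContMDiffOn 𝓘(ℝ, E) 𝓘(ℝ, ℝ) ∞ (fun w => (e.symm w).height) e.target ∧
    ∃ (f : M × ℝ → E) (O : Set (M × ℝ)), IsOpen O ∧
      ContMDiffOn (I.prod 𝓘(ℝ, ℝ)) 𝓘(ℝ, E) ∞ f O ∧
      ∀ z ∈ e.source, (z.base, z.height) ∈ O ∧ e z = f (z.base, z.height)}

/-- A chart is the restriction of a smooth map on an open set of `M × ℝ`, so smoothness can be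
tested on the two coordinates. This also yields compatibility of charts without computing transition
maps. -/
theorem contMDiffWithinAt_comp_of_mem_charts {F : Type*} [NormedAddCommGroup F] [NormedSpace ℝ F]
    {G : Type*} [TopologicalSpace G] {J : ModelWithCorners ℝ F G}
    {N : Type*} [TopologicalSpace N] [ChartedSpace G N] {h : N → D.Double} {s : Set N} {n : N}
    {e : OpenPartialHomeomorph D.Double E} (he : e ∈ charts D) (hn : h n ∈ e.source)
    (h₁ : ContMDiffWithinAt J I ∞ (fun n => (h n).base) s n)
    (h₂ : ContMDiffWithinAt J 𝓘(ℝ, ℝ) ∞ (fun n => (h n).height) s n) :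
    ContMDiffWithinAt J 𝓘(ℝ, E) ∞ (e ∘ h) s n := by
  obtain ⟨-, -, f, O, hO, hf, hef⟩ := he
  have hc : ContinuousWithinAt h s n :=
    continuousWithinAt_of_coord h₁.continuousWithinAt h₂.continuousWithinAt
  have h3 : ContMDiffWithinAt J 𝓘(ℝ, E) ∞ (f ∘ fun n => ((h n).base, (h n).height)) s n :=
    ContMDiffAt.comp_contMDiffWithinAt n (hf.contMDiffAt (hO.mem_nhds (hef _ hn).1))
      (h₁.prodMk h₂)
  refine h3.congr_of_eventuallyEq ?_ (hef _ hn).2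
  filter_upwards [hc.preimage_mem_nhdsWithin (e.open_source.mem_nhds hn)] with m hm
  exact (hef _ hm).2

variable [FiniteDimensional ℝ E]

/-- Implicit function theorem: in a chart of `M` the defining function becomes the last coordinate
of `θ`, and the remaining coordinates of `θ` parametrise its zero set. -/
theorem exists_mem_charts (z : D.Double) : ∃ e ∈ charts D, z ∈ e.source := by
  obtain ⟨Φ, hzΦ, hreg⟩ : ∃ Φ : PartialDiffeomorph I 𝓘(ℝ, E) M E ∞,
      z.base ∈ Φ.source ∧ (z.height = 0 → fderiv ℝ (D.fn ∘ Φ.symm) (Φ z.base) ≠ 0) := by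
    by_cases h : z.height = 0
    · obtain ⟨Φ, h1, h2⟩ := D.regular z.base (by have := z.eq_level; rw [h] at this; linarith)
      exact ⟨Φ, h1, fun _ => h2⟩
    · obtain ⟨Φ, h1⟩ := D.exists_chart z.base (by nlinarith [z.eq_level, sq_nonneg z.height])
      exact ⟨Φ, h1, fun h' => absurd h' h⟩
  have hsymm : ContMDiffOn 𝓘(ℝ, E) I ∞ Φ.symm Φ.target := Φ.contMDiffOn_invFun
  have hΦleft : ∀ x ∈ Φ.source, Φ.symm (Φ x) = x := fun x hx => Φ.toPartialEquiv.left_inv hx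
  have hΦright : ∀ y ∈ Φ.target, Φ (Φ.symm y) = y := fun y hy => Φ.toPartialEquiv.right_inv hy
  have hΦt : ∀ x ∈ Φ.source, Φ x ∈ Φ.target := fun x hx => Φ.toPartialEquiv.map_source hx
  have hΦs : ∀ y ∈ Φ.target, Φ.symm y ∈ Φ.source := fun y hy => Φ.toPartialEquiv.map_target hy
  have hg : ContDiffOn ℝ ∞ (D.fn ∘ Φ.symm) Φ.target :=
    contMDiffOn_iff_contDiffOn.1 (D.smooth.comp_contMDiffOn hsymm)
  let F : E × ℝ → ℝ := fun q => (D.fn ∘ Φ.symm) q.1 - q.2 ^ 2 - D.level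
  have hO : IsOpen (Prod.fst ⁻¹' Φ.target : Set (E × ℝ)) := Φ.open_target.preimage continuous_fst
  have hF : ContDiffOn ℝ ∞ F (Prod.fst ⁻¹' Φ.target) :=
    ((hg.comp contDiff_fst.contDiffOn fun q hq => hq).sub
      (contDiff_snd.pow 2).contDiffOn).sub contDiffOn_const
  -- The derivative in direction `(0, 1)` is `-2t`, nonzero off height zero; at height zero the
  -- directions `(v, 0)` recover the derivative of the level function.
  have hFd : fderiv ℝ F (Φ z.base, z.height) ≠ 0 := by
    have h1 := ((hg.contDiffAt (Φ.open_target.mem_nhds (hΦt _ hzΦ))).differentiableAt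
      (by simp)).hasFDerivAt
    have h2 := ((h1.comp (Φ z.base, z.height) (hasFDerivAt_fst (𝕜 := ℝ)
      (p := (Φ z.base, z.height)))).sub ((hasFDerivAt_snd (𝕜 := ℝ)
      (p := (Φ z.base, z.height))).pow 2)).sub_const D.level
    change HasFDerivAt F _ (Φ z.base, z.height) at h2
    rw [h2.fderiv]
    intro h0
    by_cases h : z.height = 0
    · refine hreg h (ContinuousLinearMap.ext fun v => ?_)
      have := congrArg (fun T : E × ℝ →L[ℝ] ℝ => T (v, 0)) h0
      simpa using this
    · have := congrArg (fun T : E × ℝ →L[ℝ] ℝ => T (0, 1)) h0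
      simp at this
      exact h this
  obtain ⟨θ, hzθ, hθO, hθ, hθs, hθ2⟩ := exists_straightening (E₀ := E)
    (by rw [Module.finrank_prod, Module.finrank_self]) hO hF (p := (Φ z.base, z.height))
    (hΦt _ hzΦ) hFd
  let O : Set (M × ℝ) := (Φ.source ×ˢ Set.univ) ∩ (fun p : M × ℝ => (Φ p.1, p.2)) ⁻¹' θ.source
  have hΦsm : ContMDiffOn (I.prod 𝓘(ℝ, ℝ)) 𝓘(ℝ, E × ℝ) ∞ (fun p : M × ℝ => (Φ p.1, p.2))
      (Φ.source ×ˢ Set.univ) :=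
    (Φ.contMDiffOn.comp contMDiff_fst.contMDiffOn fun p hp => hp.1).prodMk_space
      contMDiff_snd.contMDiffOn
  have hOo : IsOpen O :=
    hΦsm.continuousOn.isOpen_inter_preimage (Φ.open_source.prod isOpen_univ) θ.open_source
  let f : M × ℝ → E := fun p => (θ (Φ p.1, p.2)).1
  have hf : ContMDiffOn (I.prod 𝓘(ℝ, ℝ)) 𝓘(ℝ, E) ∞ f O :=
    (contDiff_fst.comp_contDiffOn hθ).contMDiffOn.comp (hΦsm.mono Set.inter_subset_left)
      fun p hp => hp.2
  let A : E → M × ℝ := fun w => (Φ.symm (θ.symm (w, 0)).1, (θ.symm (w, 0)).2)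
  let T : Set E := {w | (w, (0 : ℝ)) ∈ θ.target}
  have hT : IsOpen T := θ.open_target.preimage (by fun_prop)
  have hθT : ContDiffOn ℝ ∞ (fun w : E => θ.symm (w, 0)) T :=
    hθs.comp (contDiff_id.prodMk contDiff_const).contDiffOn fun w hw => hw
  have hθtar : ∀ w ∈ T, (θ.symm (w, 0)).1 ∈ Φ.target := fun w hw => hθO (θ.map_target hw)
  have hA1 : ContMDiffOn 𝓘(ℝ, E) I ∞ (fun w => (A w).1) T :=
    hsymm.comp (contDiff_fst.comp_contDiffOn hθT).contMDiffOn hθtar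
  have hA2 : ContMDiffOn 𝓘(ℝ, E) 𝓘(ℝ, ℝ) ∞ (fun w => (A w).2) T :=
    (contDiff_snd.comp_contDiffOn hθT).contMDiffOn
  have hAlev : ∀ w ∈ T, D.fn (A w).1 - (A w).2 ^ 2 = D.level := fun w hw => by
    have h1 := hθ2 _ (θ.map_target hw)
    rw [θ.right_inv hw] at h1
    exact (sub_eq_zero.1 h1.symm)
  have hθz : ∀ z : D.Double, (z.base, z.height) ∈ O →
      θ (Φ z.base, z.height) = (f (z.base, z.height), 0) := fun z hz => by
    refine Prod.ext rfl ?_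
    rw [hθ2 _ hz.2]
    change D.fn (Φ.symm (Φ z.base)) - z.height ^ 2 - D.level = 0
    rw [hΦleft _ hz.1.1, z.eq_level, sub_self]
  have hcoord : Continuous fun z : D.Double => (z.base, z.height) :=
    continuous_base.prodMk continuous_height
  let e : OpenPartialHomeomorph D.Double E :=
    { toFun := fun z => f (z.base, z.height)
      invFun := fun w => mkD z (A w)
      source := {z | (z.base, z.height) ∈ O}
      target := T
      map_source' := fun z hz => by
        change (f (z.base, z.height), (0 : ℝ)) ∈ θ.target
        rw [← hθz z hz]
        exact θ.map_source hz.2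
      map_target' := fun w hw => by
        rw [Set.mem_ofPred_eq, base_mkD (hAlev w hw), height_mkD (hAlev w hw)]
        refine ⟨⟨hΦs _ (hθtar w hw), trivial⟩, ?_⟩
        change (Φ (Φ.symm (θ.symm (w, 0)).1), (θ.symm (w, 0)).2) ∈ θ.source
        rw [hΦright _ (hθtar w hw)]
        exact θ.map_target hw
      left_inv' := fun y hy => by
        have : A (f (y.base, y.height)) = (y.base, y.height) := by
          change (Φ.symm (θ.symm (f (y.base, y.height), 0)).1,
            (θ.symm (f (y.base, y.height), 0)).2) = _
          rw [← hθz y hy, θ.left_inv hy.2, hΦleft _ hy.1.1]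
        rw [this, mkD_coord]
      right_inv' := fun w hw => by
        rw [base_mkD (hAlev w hw), height_mkD (hAlev w hw)]
        change (θ (Φ (Φ.symm (θ.symm (w, 0)).1), (θ.symm (w, 0)).2)).1 = w
        rw [hΦright _ (hθtar w hw), Prod.mk.eta, θ.right_inv hw]
      open_source := hOo.preimage hcoord
      open_target := hT
      continuousOn_toFun := hf.continuousOn.comp hcoord.continuousOn fun z hz => hz
      continuousOn_invFun := fun w hw => continuousWithinAt_of_coord
        ((hA1.continuousOn w hw).congr (fun y hy => base_mkD (hAlev y hy)) (base_mkD (hAlev w hw)))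
        ((hA2.continuousOn w hw).congr (fun y hy => height_mkD (hAlev y hy))
          (height_mkD (hAlev w hw))) }
  refine ⟨e, ⟨?_, ?_, f, O, hOo, hf, fun z hz => ⟨hz, rfl⟩⟩, ⟨⟨hzΦ, trivial⟩, hzθ⟩⟩
  · exact hA1.congr fun y hy => base_mkD (hAlev y hy)
  · exact hA2.congr fun y hy => height_mkD (hAlev y hy)

noncomputable instance : ChartedSpace E D.Double where
  atlas := charts D
  chartAt z := (exists_mem_charts z).choose
  mem_chart_source z := (exists_mem_charts z).choose_spec.2
  chart_mem_atlas z := (exists_mem_charts z).choose_spec.1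

instance : IsManifold 𝓘(ℝ, E) ∞ D.Double := by
  refine isManifold_of_contDiffOn _ _ _ fun e e' he he' => ?_
  simp only [modelWithCornersSelf_coe, modelWithCornersSelf_coe_symm, Set.range_id, Set.inter_univ,
    Set.preimage_id, Function.id_comp, Function.comp_id]
  rw [← contMDiffOn_iff_contDiffOn]
  intro w hw
  rw [OpenPartialHomeomorph.trans_source] at hw
  exact contMDiffWithinAt_comp_of_mem_charts he' hw.2
    ((he.1 w hw.1).mono fun y hy => hy.1) ((he.2.1 w hw.1).mono fun y hy => hy.1)

theorem contMDiffWithinAt_of_coord {F : Type*} [NormedAddCommGroup F] [NormedSpace ℝ F]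
    {G : Type*} [TopologicalSpace G] {J : ModelWithCorners ℝ F G}
    {N : Type*} [TopologicalSpace N] [ChartedSpace G N] {h : N → D.Double} {s : Set N} {n : N}
    (h₁ : ContMDiffWithinAt J I ∞ (fun n => (h n).base) s n)
    (h₂ : ContMDiffWithinAt J 𝓘(ℝ, ℝ) ∞ (fun n => (h n).height) s n) :
    ContMDiffWithinAt J 𝓘(ℝ, E) ∞ h s n := by
  rw [contMDiffWithinAt_iff_target]
  refine ⟨continuousWithinAt_of_coord h₁.continuousWithinAt h₂.continuousWithinAt, ?_⟩
  have := contMDiffWithinAt_comp_of_mem_charts (chart_mem_atlas E (h n)) (mem_chart_source E (h n)) h₁ h₂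
  exact this

theorem contMDiff_base : ContMDiff 𝓘(ℝ, E) I ∞ (base : D.Double → M) := fun z => by
  have h1 : ContMDiffAt 𝓘(ℝ, E) 𝓘(ℝ, E) ∞ (chartAt E z) z := contMDiffAt_extChartAt
  have h2 := (chart_mem_atlas E z : _ ∈ charts D).1.contMDiffAt
    ((chartAt E z).open_target.mem_nhds (mem_chart_target E z))
  refine (h2.comp z h1).congr_of_eventuallyEq ?_
  filter_upwards [(chartAt E z).open_source.mem_nhds (mem_chart_source E z)] with y hy
  exact (congrArg base ((chartAt E z).left_inv hy)).symm

theorem contMDiff_height : ContMDiff 𝓘(ℝ, E) 𝓘(ℝ, ℝ) ∞ (height : D.Double → ℝ) := fun z => by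
  have h1 : ContMDiffAt 𝓘(ℝ, E) 𝓘(ℝ, E) ∞ (chartAt E z) z := contMDiffAt_extChartAt
  have h2 := (chart_mem_atlas E z : _ ∈ charts D).2.1.contMDiffAt
    ((chartAt E z).open_target.mem_nhds (mem_chart_target E z))
  refine (h2.comp z h1).congr_of_eventuallyEq ?_
  filter_upwards [(chartAt E z).open_source.mem_nhds (mem_chart_source E z)] with y hy
  exact (congrArg height ((chartAt E z).left_inv hy)).symm

/-- A map that preserves the defining functions lifts to the doubles. -/
def map (F : M → M') (hF : ∀ x, D'.fn (F x) = D.fn x) (hl : D'.level = D.level) (z : D.Double) :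
    D'.Double :=
  ⟨(F z.base, z.height), by rw [hF, hl]; exact z.eq_level⟩

section Map

variable {F : M → M'} {hF : ∀ x, D'.fn (F x) = D.fn x} {hl : D'.level = D.level}

theorem contMDiff_map (hs : ContMDiff I I ∞ F) :
    ContMDiff 𝓘(ℝ, E) 𝓘(ℝ, E) ∞ (map F hF hl) := fun _ =>
  contMDiffWithinAt_of_coord ((hs.comp contMDiff_base).contMDiffAt.contMDiffWithinAt)
    contMDiff_height.contMDiffAt.contMDiffWithinAt

/-- The local inverse applies a local inverse of `F` to the base and keeps the height. -/
theorem isLocalDiffeomorph_map (hs : IsLocalDiffeomorph I I ∞ F) :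
    IsLocalDiffeomorph 𝓘(ℝ, E) 𝓘(ℝ, E) ∞ (map F hF hl) := by
  intro z
  obtain ⟨Φ, hz, hΦ⟩ := hs z.base
  have hsymm : ContMDiffOn I I ∞ Φ.symm Φ.target := Φ.contMDiffOn_invFun
  have hlev : ∀ y : D'.Double, y.base ∈ Φ.target →
      D.fn (Φ.symm y.base) - y.height ^ 2 = D.level := fun y hy => by
    have h1 : F (Φ.symm y.base) = y.base :=
      (hΦ (Φ.toPartialEquiv.map_target hy)).trans (Φ.toPartialEquiv.right_inv hy)
    rw [← hF, h1, ← hl]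
    exact y.eq_level
  refine ⟨{ toFun := map F hF hl
            invFun := fun y => mkD z (Φ.symm y.base, y.height)
            source := base ⁻¹' Φ.source
            target := base ⁻¹' Φ.target
            map_source' := fun y hy => ?_
            map_target' := fun y hy => ?_
            left_inv' := fun y hy => ?_
            right_inv' := fun y hy => ?_
            open_source := Φ.open_source.preimage continuous_base
            open_target := Φ.open_target.preimage continuous_base
            contMDiffOn_toFun := (contMDiff_map hs.contMDiff).contMDiffOn
            contMDiffOn_invFun := fun y hy => ?_ }, hz, fun _ _ => rfl⟩
  · change F y.base ∈ Φ.target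
    rw [hΦ hy]
    exact Φ.toPartialEquiv.map_source hy
  · change (mkD z (Φ.symm y.base, y.height)).base ∈ Φ.source
    rw [base_mkD (hlev y hy)]
    exact Φ.toPartialEquiv.map_target hy
  · have h1 : Φ.symm (F y.base) = y.base := by
      rw [hΦ hy]; exact Φ.toPartialEquiv.left_inv hy
    change mkD z (Φ.symm (F y.base), y.height) = y
    rw [h1, mkD_coord]
  · refine ext ?_ (height_mkD (D := D) (p := (Φ.symm y.base, y.height)) (hlev y hy))
    change F (mkD z (Φ.symm y.base, y.height)).base = y.base
    rw [base_mkD (hlev y hy)]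
    exact (hΦ (Φ.toPartialEquiv.map_target hy)).trans (Φ.toPartialEquiv.right_inv hy)
  · refine contMDiffWithinAt_of_coord ?_ ?_
    · exact (hsymm.comp contMDiff_base.contMDiffOn (fun _ h => h) y hy).congr
        (fun x hx => base_mkD (hlev x hx)) (base_mkD (hlev y hy))
    · exact (contMDiff_height.contMDiffOn y hy).congr
        (fun x hx => height_mkD (hlev x hx)) (height_mkD (hlev y hy))

end Map

section Upper

/-- The embedding of an open superlevel set as the upper half of the double. -/
noncomputable def upper (U : TopologicalSpace.Opens M) (hU : ∀ x ∈ U, D.level < D.fn x) (x : U) :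
    D.Double :=
  ⟨(x.1, √(D.fn x.1 - D.level)), by
    have := hU x.1 x.2
    rw [Real.sq_sqrt (by linarith)]; ring⟩

variable {U : TopologicalSpace.Opens M} {hU : ∀ x ∈ U, D.level < D.fn x}

theorem contMDiff_upper : ContMDiff I 𝓘(ℝ, E) ∞ (upper U hU) := fun x => by
  have h1 : ContMDiff I 𝓘(ℝ, ℝ) ∞ (fun x : U => D.fn x.1) := D.smooth.comp contMDiff_subtype_val
  refine contMDiffWithinAt_of_coord contMDiff_subtype_val.contMDiffAt.contMDiffWithinAt ?_
  have h2 : ContDiffAt ℝ ∞ (fun y => √(y - D.level)) (D.fn x.1) :=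
    (contDiffAt_id.sub contDiffAt_const).sqrt (by
      have := hU x.1 x.2
      simp only [id]; linarith)
  exact (h2.contMDiffAt.comp x h1.contMDiffAt).contMDiffWithinAt

/-- When `U` is the whole open superlevel set, the image is exactly the open half `height > 0`, with
inverse `base`. -/
theorem isLocalDiffeomorph_upper (hU' : ∀ x, D.level < D.fn x → x ∈ U) :
    IsLocalDiffeomorph I 𝓘(ℝ, E) ∞ (upper U hU) := by
  classical
  intro x₀
  have hmem : ∀ z : D.Double, 0 < z.height → z.base ∈ U := fun z hz =>
    hU' _ (by nlinarith [z.eq_level, pow_pos hz 2])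
  refine ⟨{ toFun := upper U hU
            invFun := fun z => if h : z.base ∈ U then ⟨z.base, h⟩ else x₀
            source := Set.univ
            target := {z | 0 < z.height}
            map_source' := fun y _ => ?_
            map_target' := fun y hy => trivial
            left_inv' := fun y _ => ?_
            right_inv' := fun y hy => ?_
            open_source := isOpen_univ
            open_target := isOpen_lt continuous_const continuous_height
            contMDiffOn_toFun := contMDiff_upper.contMDiffOn
            contMDiffOn_invFun := fun y hy => ?_ }, trivial, fun _ _ => rfl⟩
  · exact Real.sqrt_pos.2 (sub_pos.2 (hU _ y.2))
  · exact dif_pos y.2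
  · have hy' : 0 < y.height := hy
    rw [dif_pos (hmem y hy)]
    refine ext rfl ?_
    change √(D.fn y.base - D.level) = y.height
    rw [show D.fn y.base - D.level = y.height ^ 2 by linarith [y.eq_level], Real.sqrt_sq hy'.le]
  · refine ContMDiffAt.contMDiffWithinAt ?_
    rw [← ContMDiffAt.subtypeVal_comp_iff]
    refine (contMDiff_base y).congr_of_eventuallyEq ?_
    filter_upwards [(isOpen_lt continuous_const continuous_height).mem_nhds hy] with z hz
    exact congrArg Subtype.val (dif_pos (hmem z hz))

end Upper

end Double

end RegularLevel

end LevelDouble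

/-! ### Averaging over arrows -/

namespace Orbifold

section Average

variable {E : Type v} [NormedAddCommGroup E] [NormedSpace ℝ E]
  {H : Type w} [TopologicalSpace H] {I : ModelWithCorners ℝ E H} (𝒴 : Orbifold.{u} I)

theorem continuous_tgt : Continuous 𝒴.tgt := 𝒴.tgt_localDiffeo.contMDiff.continuous

theorem pt_eq_pt_iff {x y : 𝒴.Obj} : 𝒴.pt x = 𝒴.pt y ↔ ∃ g, 𝒴.src g = x ∧ 𝒴.tgt g = y :=
  Quotient.eq (r := 𝒴.orbitRel)

/-- The saturation of `A` is `src (tgt⁻¹ A)`, open because `src` is an open map. -/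
theorem isOpenMap_pt : IsOpenMap 𝒴.pt := by
  intro A hA
  refine isQuotientMap_quotient_mk'.isOpen_preimage.1 ?_
  have : (Quotient.mk 𝒴.orbitRel) ⁻¹' (𝒴.pt '' A) = 𝒴.src '' (𝒴.tgt ⁻¹' A) := by
    ext x
    constructor
    · rintro ⟨y, hy, hxy⟩
      obtain ⟨g, hg, hg'⟩ := 𝒴.pt_eq_pt_iff.1 hxy.symm
      exact ⟨g, by rwa [Set.mem_preimage, hg'], hg⟩
    · rintro ⟨g, hg, rfl⟩
      exact ⟨𝒴.tgt g, hg, (𝒴.pt_src g).symm⟩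
  exact this ▸ 𝒴.src_localDiffeo.isLocalHomeomorph.isOpenMap _ (hA.preimage 𝒴.continuous_tgt)

/-- The set is compact by properness and discrete because `src` is locally injective. -/
theorem finite_arrows (x : 𝒴.Obj) {K : Set 𝒴.Obj} (hK : IsCompact K) :
    {g | 𝒴.src g = x ∧ 𝒴.tgt g ∈ K}.Finite := by
  have hc : IsCompact {g | 𝒴.src g = x ∧ 𝒴.tgt g ∈ K} := by
    have := 𝒴.proper.isCompact_preimage (isCompact_singleton (x := x) |>.prod hK)
    convert this using 1
    ext g
    simp [Set.mem_prod]
  obtain ⟨t, -, ht⟩ := hc.elim_nhds_subcover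
    (fun g => (𝒴.src_localDiffeo g).choose.source) fun g _ =>
      (𝒴.src_localDiffeo g).choose.open_source.mem_nhds (𝒴.src_localDiffeo g).choose_spec.1
  refine Set.Finite.subset (t.finite_toSet.biUnion (t := fun g =>
    {k | k ∈ (𝒴.src_localDiffeo g).choose.source ∧ 𝒴.src k = x}) fun g _ => ?_) ?_
  · refine Set.Subsingleton.finite fun k hk k' hk' => ?_
    obtain ⟨h1, h2⟩ := (𝒴.src_localDiffeo g).choose_spec
    refine (𝒴.src_localDiffeo g).choose.toPartialEquiv.injOn hk.1 hk'.1 ?_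
    exact (h2 hk.1).symm.trans ((hk.2.trans hk'.2.symm).trans (h2 hk'.1))
  · intro k hk
    obtain ⟨g, hg, hkg⟩ := Set.mem_iUnion₂.1 (ht hk)
    exact Set.mem_iUnion₂.2 ⟨g, hg, hkg, hk.1⟩

/-- The arrows from a point near `x` into a compact set `K` are close to arrows from `x` into
`K`. -/
theorem eventually_arrows_subset (x : 𝒴.Obj) {K : Set 𝒴.Obj} (hK : IsCompact K) {N : Set 𝒴.Arr}
    (hN : IsOpen N) (h : ∀ g, 𝒴.src g = x → 𝒴.tgt g ∈ K → g ∈ N) :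
    ∀ᶠ y in 𝓝 x, ∀ g, 𝒴.src g = y → 𝒴.tgt g ∈ K → g ∈ N := by
  have h1 : ∀ k ∈ K, ∀ᶠ p : 𝒴.Obj × 𝒴.Obj in 𝓝 (x, k), ∀ g, (𝒴.src g, 𝒴.tgt g) = p → g ∈ N := by
    intro k hk
    refine 𝒴.proper.isClosedMap.eventually_nhds_fiber (p := fun g => g ∈ N) (x, k) fun g hg => ?_
    exact hN.mem_nhds (h g (congrArg Prod.fst hg) (by
      have h1 : 𝒴.tgt g = k := congrArg Prod.snd hg
      rwa [h1]))
  have h2 := hK.eventually_forall_of_forall_eventually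
    (P := fun y k => ∀ g, (𝒴.src g, 𝒴.tgt g) = (y, k) → g ∈ N) h1
  filter_upwards [h2] with y hy g hg hgK
  exact hy (𝒴.tgt g) hgK g (by rw [hg])

/-- The sum of the values of `h` at the targets of all arrows starting at `x`. -/
noncomputable def orbitSum (h : 𝒴.Obj → ℝ) (x : 𝒴.Obj) : ℝ :=
  ∑ᶠ g ∈ {g | 𝒴.src g = x}, h (𝒴.tgt g)

variable {𝒴}

/-- Precomposition with `k` is a target-preserving bijection from the arrows out of `tgt k` to those
out of `src k`. -/
theorem orbitSum_src_eq (h : 𝒴.Obj → ℝ) (k : 𝒴.Arr) :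
    𝒴.orbitSum h (𝒴.src k) = 𝒴.orbitSum h (𝒴.tgt k) := by
  classical
  symm
  let φ : 𝒴.Arr → 𝒴.Arr := fun g => if p : 𝒴.tgt k = 𝒴.src g then 𝒴.comp k g p else g
  have hφ : ∀ g (p : 𝒴.tgt k = 𝒴.src g), φ g = 𝒴.comp k g p := fun g p => dif_pos p
  have hcancel : ∀ g (p : 𝒴.tgt k = 𝒴.src g),
      𝒴.comp (𝒴.inv k) (𝒴.comp k g p) ((𝒴.tgt_inv k).trans (𝒴.src_comp k g p).symm) = g := by
    intro g p
    rw [← 𝒴.assoc (𝒴.inv k) k g (𝒴.tgt_inv k) p]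
    have : ∀ e (he : e = 𝒴.unit (𝒴.src g)) q, 𝒴.comp e g q = g := by
      rintro e rfl q
      exact 𝒴.unit_comp g
    exact this _ ((𝒴.inv_comp k).trans (congrArg 𝒴.unit p)) _
  have hcancel' : ∀ g (p : 𝒴.src k = 𝒴.src g),
      𝒴.comp k (𝒴.comp (𝒴.inv k) g ((𝒴.tgt_inv k).trans p))
        ((𝒴.src_inv k).symm.trans (𝒴.src_comp _ _ _).symm) = g := by
    intro g p
    rw [← 𝒴.assoc k (𝒴.inv k) g (𝒴.src_inv k).symm ((𝒴.tgt_inv k).trans p)]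
    have : ∀ e (he : e = 𝒴.unit (𝒴.src g)) q, 𝒴.comp e g q = g := by
      rintro e rfl q
      exact 𝒴.unit_comp g
    exact this _ ((𝒴.comp_inv k).trans (congrArg 𝒴.unit p)) _
  refine finsum_mem_eq_of_bijOn φ ⟨?_, ?_, ?_⟩ ?_
  · intro g hg
    rw [hφ g (Eq.symm hg)]
    exact 𝒴.src_comp _ _ _
  · intro g hg g' hg' hgg
    rw [hφ g (Eq.symm hg), hφ g' (Eq.symm hg')] at hgg
    rw [← hcancel g (Eq.symm hg), ← hcancel g' (Eq.symm hg')]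
    congr 1
  · intro g hg
    refine ⟨𝒴.comp (𝒴.inv k) g ((𝒴.tgt_inv k).trans (Eq.symm hg)), ?_, ?_⟩
    · exact (𝒴.src_comp _ _ _).trans (𝒴.src_inv k)
    · rw [hφ _ ((𝒴.src_inv k).symm.trans (𝒴.src_comp _ _ _).symm)]
      exact hcancel' g (Eq.symm hg)
  · intro g hg
    rw [hφ g (Eq.symm hg), 𝒴.tgt_comp]

theorem orbitSum_eq_of_pt_eq (h : 𝒴.Obj → ℝ) {x y : 𝒴.Obj} (hxy : 𝒴.pt x = 𝒴.pt y) :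
    𝒴.orbitSum h x = 𝒴.orbitSum h y := by
  obtain ⟨g, rfl, rfl⟩ := 𝒴.pt_eq_pt_iff.1 hxy
  exact orbitSum_src_eq h g

theorem finite_support_orbitSum {h : 𝒴.Obj → ℝ} (hc : HasCompactSupport h) (x : 𝒴.Obj) :
    ({g | 𝒴.src g = x} ∩ Function.support fun g => h (𝒴.tgt g)).Finite :=
  (𝒴.finite_arrows x hc).subset fun _ hg => ⟨hg.1, subset_tsupport _ hg.2⟩

theorem orbitSum_pos {h : 𝒴.Obj → ℝ} (hc : HasCompactSupport h) (h0 : ∀ x, 0 ≤ h x)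
    {g : 𝒴.Arr} (hg : 0 < h (𝒴.tgt g)) : 0 < 𝒴.orbitSum h (𝒴.src g) := by
  rw [orbitSum, ← finsum_mem_inter_support, finsum_mem_eq_finite_toFinset_sum _
    (finite_support_orbitSum hc _)]
  refine Finset.sum_pos' (fun _ _ => h0 _) ⟨g, ?_, hg⟩
  rw [Set.Finite.mem_toFinset]
  exact ⟨rfl, hg.ne'⟩

theorem exists_arrow_of_orbitSum_pos {h : 𝒴.Obj → ℝ} {x : 𝒴.Obj} (hx : 0 < 𝒴.orbitSum h x) :
    ∃ g, 𝒴.src g = x ∧ h (𝒴.tgt g) ≠ 0 := by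
  obtain ⟨g, hg, hg'⟩ := exists_ne_zero_of_finsum_mem_ne_zero hx.ne'
  exact ⟨g, hg, hg'⟩

/-- Near `x`, every arrow contributing to the sum lies on one of the local sections of `src` through
the finitely many arrows from `x` into the support. The sum is therefore a fixed finite sum of
smooth functions. -/
theorem contMDiff_orbitSum {h : 𝒴.Obj → ℝ} (hs : ContMDiff I 𝓘(ℝ, ℝ) ∞ h)
    (hc : HasCompactSupport h) : ContMDiff I 𝓘(ℝ, ℝ) ∞ (𝒴.orbitSum h) := by
  classical
  intro x
  have hfin := 𝒴.finite_arrows x hc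
  -- Disjoint neighbourhoods keep the sections distinct, so no arrow is counted twice.
  obtain ⟨U, hU, hUd⟩ := hfin.t2_separation
  choose Φ hΦ hΦs using 𝒴.src_localDiffeo
  have hev := 𝒴.eventually_arrows_subset x hc
    (N := ⋃ g ∈ {g | 𝒴.src g = x ∧ 𝒴.tgt g ∈ tsupport h}, (Φ g).source ∩ U g)
    (isOpen_biUnion fun g _ => (Φ g).open_source.inter (hU g).2)
    fun g hg hg' => Set.mem_iUnion₂.2 ⟨g, ⟨hg, hg'⟩, hΦ g, (hU g).1⟩
  have hev2 : ∀ᶠ y in 𝓝 x, ∀ g ∈ {g | 𝒴.src g = x ∧ 𝒴.tgt g ∈ tsupport h},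
      y ∈ (Φ g).target ∧ (Φ g).symm y ∈ U g := by
    rw [Filter.eventually_all_finite hfin]
    intro g hg
    have hxt : x ∈ (Φ g).target := by
      rw [← hg.1, hΦs g (hΦ g)]; exact (Φ g).toPartialEquiv.map_source (hΦ g)
    have hxg : (Φ g).symm x = g := by
      rw [← hg.1, hΦs g (hΦ g)]; exact (Φ g).toPartialEquiv.left_inv (hΦ g)
    have h1 : ∀ᶠ y in 𝓝 x, y ∈ (Φ g).target := (Φ g).open_target.mem_nhds hxt
    have hcont : ContinuousAt (Φ g).symm x :=
      (Φ g).symm.contMDiffOn.continuousOn.continuousAt ((Φ g).open_target.mem_nhds hxt)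
    exact h1.and (hcont.eventually_mem ((hU g).2.mem_nhds (hxg.symm ▸ (hU g).1)))
  have hsum : ContMDiffAt I 𝓘(ℝ, ℝ) ∞
      (fun y => ∑ g ∈ hfin.toFinset, h (𝒴.tgt ((Φ g).symm y))) x := by
    refine ContMDiffAt.sum fun g hg => ?_
    rw [Set.Finite.mem_toFinset] at hg
    have hxt : x ∈ (Φ g).target := by
      rw [← hg.1, hΦs g (hΦ g)]; exact (Φ g).toPartialEquiv.map_source (hΦ g)
    exact (hs.comp 𝒴.tgt_localDiffeo.contMDiff).contMDiffAt.comp x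
      ((Φ g).symm.contMDiffOn.contMDiffAt ((Φ g).open_target.mem_nhds hxt))
  refine hsum.congr_of_eventuallyEq ?_
  filter_upwards [hev, hev2] with y hy hy2
  have hsrc : ∀ g ∈ {g | 𝒴.src g = x ∧ 𝒴.tgt g ∈ tsupport h}, 𝒴.src ((Φ g).symm y) = y := by
    intro g hg
    exact (hΦs g ((Φ g).toPartialEquiv.map_target (hy2 g hg).1)).trans <|
      (Φ g).toPartialEquiv.right_inv (hy2 g hg).1
  have hinj : Set.InjOn (fun g => (Φ g).symm y) (hfin.toFinset : Set 𝒴.Arr) := by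
    intro g hg g' hg' hgg
    rw [Set.Finite.coe_toFinset] at hg hg'
    by_contra hne
    refine Set.disjoint_left.1 (hUd hg hg' hne) (hy2 g hg).2 ?_
    have : (Φ g).symm y = (Φ g').symm y := hgg
    rw [this]
    exact (hy2 g' hg').2
  rw [← Finset.sum_image (f := fun k => h (𝒴.tgt k)) hinj, orbitSum]
  refine finsum_mem_eq_sum_of_inter_support_eq _ ?_
  ext k
  simp only [Set.mem_inter_iff, Set.mem_ofPred_eq, Finset.coe_image, Set.mem_image,
    Set.Finite.coe_toFinset]
  refine and_congr_left fun hk => ⟨fun hk1 => ?_, ?_⟩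
  · obtain ⟨g, hg, hkg⟩ := Set.mem_iUnion₂.1 (hy k hk1 (subset_tsupport _ hk))
    refine ⟨g, hg, ?_⟩
    rw [← hk1, hΦs g hkg.1]
    exact (Φ g).toPartialEquiv.left_inv hkg.1
  · rintro ⟨g, hg, rfl⟩
    exact hsrc g hg

end Average

end Orbifold

/-! ### Interior charts and regular levels -/

section Charts

variable {E : Type v} [NormedAddCommGroup E] [NormedSpace ℝ E]
  {H : Type w} [TopologicalSpace H] {I : ModelWithCorners ℝ E H}
  {M : Type u} [TopologicalSpace M] [ChartedSpace H M]
  {M' : Type u} [TopologicalSpace M'] [ChartedSpace H M']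

theorem exists_partialDiffeomorph_of_isInteriorPoint [IsManifold I ∞ M] {x : M}
    (hx : I.IsInteriorPoint x) :
    ∃ Φ : PartialDiffeomorph I 𝓘(ℝ, E) M E ∞, x ∈ Φ.source := by
  let e := extChartAt I x
  have hsub : interior (Set.range I) ∩ I.symm ⁻¹' (chartAt H x).target ⊆ e.target := by
    rintro y ⟨hy1, hy2⟩
    rw [extChartAt_target]
    exact ⟨hy2, interior_subset hy1⟩
  refine ⟨{ toFun := e
            invFun := e.symm
            source := e.source ∩ e ⁻¹' interior (Set.range I)
            target := interior (Set.range I) ∩ I.symm ⁻¹' (chartAt H x).target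
            map_source' := fun y hy => ⟨hy.2, ?_⟩
            map_target' := fun y hy => ⟨e.map_target (hsub hy), ?_⟩
            left_inv' := fun y hy => e.left_inv hy.1
            right_inv' := fun y hy => e.right_inv (hsub hy)
            open_source := ?_
            open_target := ?_
            contMDiffOn_toFun := ?_
            contMDiffOn_invFun := (contMDiffOn_extChartAt_symm x).mono hsub }, ?_⟩
  · have := e.map_source hy.1
    rw [extChartAt_target] at this
    exact this.1
  · rw [Set.mem_preimage, e.right_inv (hsub hy)]
    exact hy.1
  · exact (continuousOn_extChartAt x).isOpen_inter_preimage (isOpen_extChartAt_source x)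
      isOpen_interior
  · exact isOpen_interior.inter ((chartAt H x).open_target.preimage I.continuous_symm)
  · exact contMDiffOn_extChartAt.mono fun y hy => by
      rw [← extChartAt_source I]; exact hy.1
  · exact ⟨mem_extChartAt_source x, hx⟩

/-- In a single chart around each point this is the Euclidean statement. Requiring vanishing in
every chart makes the complement match the existential field `RegularLevel.regular`. -/
theorem volume_critical_values [FiniteDimensional ℝ E] [SecondCountableTopology M] {f : M → ℝ}
    (hf : ContMDiff I 𝓘(ℝ, ℝ) ∞ f) :
    MeasureTheory.volume (f '' {x | (∃ Φ : PartialDiffeomorph I 𝓘(ℝ, E) M E ∞, x ∈ Φ.source) ∧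
      ∀ Φ : PartialDiffeomorph I 𝓘(ℝ, E) M E ∞, x ∈ Φ.source →
        fderiv ℝ (f ∘ Φ.symm) (Φ x) = 0}) = 0 := by
  refine measure_image_null_of_locally_null f _ fun x hx => ?_
  obtain ⟨⟨Φ, hxΦ⟩, -⟩ := hx
  have hg : ContDiffOn ℝ ∞ (f ∘ Φ.symm) Φ.target :=
    contMDiffOn_iff_contDiffOn.1 (hf.comp_contMDiffOn Φ.contMDiffOn_invFun)
  refine ⟨Φ.source, Φ.open_source.mem_nhds hxΦ,
    MeasureTheory.measure_mono_null ?_ (volume_image_critical Φ.open_target hg)⟩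
  rintro _ ⟨y, ⟨hy, hyΦ⟩, rfl⟩
  exact ⟨Φ y, ⟨Φ.toPartialEquiv.map_source hyΦ, hy.2 Φ hyΦ⟩,
    congrArg f (Φ.toPartialEquiv.left_inv hyΦ)⟩

/-- Regular levels pull back along local diffeomorphisms. -/
def RegularLevel.pullback (D : RegularLevel I M) {F : M' → M} (hF : IsLocalDiffeomorph I I ∞ F) :
    RegularLevel I M' where
  fn := D.fn ∘ F
  level := D.level
  smooth := D.smooth.comp hF.contMDiff
  exists_chart x hx := by
    obtain ⟨Φ, hΦ⟩ := D.exists_chart (F x) hx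
    obtain ⟨S, hxS, hS⟩ := hF x
    exact ⟨S.trans Φ, hxS, by change S x ∈ Φ.source; rwa [← hS hxS]⟩
  regular x hx := by
    obtain ⟨Φ, hΦ, hreg⟩ := D.regular (F x) hx
    obtain ⟨S, hxS, hS⟩ := hF x
    have hmem : x ∈ (S.trans Φ).source := ⟨hxS, by change S x ∈ Φ.source; rwa [← hS hxS]⟩
    refine ⟨S.trans Φ, hmem, ?_⟩
    have hval : (S.trans Φ) x = Φ (F x) := congrArg Φ (hS hxS).symm
    have hev : ((D.fn ∘ F) ∘ (S.trans Φ).symm) =ᶠ[𝓝 (Φ (F x))] D.fn ∘ Φ.symm := by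
      have hnhds := (S.trans Φ).open_target.mem_nhds ((S.trans Φ).toPartialEquiv.map_source hmem)
      rw [hval] at hnhds
      filter_upwards [hnhds] with y hy
      have h1 : Φ.symm y ∈ S.target := hy.2
      change D.fn (F (S.symm (Φ.symm y))) = D.fn (Φ.symm y)
      exact congrArg D.fn ((hS (S.toPartialEquiv.map_target h1)).trans
        (S.toPartialEquiv.right_inv h1))
    rw [hval, hev.fderiv_eq]
    exact hreg

end Charts

/-! ### A bump function meeting every orbit over a compact set -/

namespace Orbifold

section Bump

variable {E : Type v} [NormedAddCommGroup E] [NormedSpace ℝ E] [FiniteDimensional ℝ E]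
  {H : Type w} [TopologicalSpace H] {I : ModelWithCorners ℝ E H} (𝒴 : Orbifold.{u} I)

/-- Compactness of `U` lets finitely many bump functions suffice. Positivity is asked at only one
representative of each orbit, since the set of objects over `U` need not be compact. -/
theorem exists_compactlySupported_pos {U : Set 𝒴.Space} (hU : IsCompact U)
    (hUb : U ⊆ 𝒴.boundaryᶜ) :
    ∃ h : 𝒴.Obj → ℝ, ContMDiff I 𝓘(ℝ, ℝ) ∞ h ∧ HasCompactSupport h ∧ (∀ x, 0 ≤ h x) ∧
      (∀ x, h x ≠ 0 → ∃ Φ : PartialDiffeomorph I 𝓘(ℝ, E) 𝒴.Obj E ∞, x ∈ Φ.source) ∧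
      ∀ x, 𝒴.pt x ∈ U → ∃ g, 𝒴.src g = x ∧ 0 < h (𝒴.tgt g) := by
  suffices H : ∃ h : 𝒴.Obj → ℝ, ContMDiff I 𝓘(ℝ, ℝ) ∞ h ∧ HasCompactSupport h ∧ (∀ x, 0 ≤ h x) ∧
      (∀ x, h x ≠ 0 → ∃ Φ : PartialDiffeomorph I 𝓘(ℝ, E) 𝒴.Obj E ∞, x ∈ Φ.source) ∧
      U ⊆ 𝒴.pt '' {x | 0 < h x} by
    obtain ⟨h, h1, h2, h3, h4, h5⟩ := H
    refine ⟨h, h1, h2, h3, h4, fun x hx => ?_⟩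
    obtain ⟨y, hy, hxy⟩ := h5 hx
    obtain ⟨g, hg, hg'⟩ := 𝒴.pt_eq_pt_iff.1 hxy.symm
    exact ⟨g, hg, by rw [hg']; exact hy⟩
  refine hU.induction_on (p := fun U => ∃ h : 𝒴.Obj → ℝ, ContMDiff I 𝓘(ℝ, ℝ) ∞ h ∧
    HasCompactSupport h ∧ (∀ x, 0 ≤ h x) ∧
      (∀ x, h x ≠ 0 → ∃ Φ : PartialDiffeomorph I 𝓘(ℝ, E) 𝒴.Obj E ∞, x ∈ Φ.source) ∧
      U ⊆ 𝒴.pt '' {x | 0 < h x}) ?_ ?_ ?_ ?_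
  · exact ⟨fun _ => 0, contMDiff_const, HasCompactSupport.zero, fun _ => le_rfl,
      fun _ hx => absurd rfl hx, Set.empty_subset _⟩
  · rintro s t hst ⟨h, h1, h2, h3, h4, h5⟩
    exact ⟨h, h1, h2, h3, h4, hst.trans h5⟩
  · rintro s t ⟨h, h1, h2, h3, h4, h5⟩ ⟨k, k1, k2, k3, k4, k5⟩
    refine ⟨h + k, h1.add k1, h2.add k2, fun x => add_nonneg (h3 x) (k3 x), fun x hx => ?_,
      Set.union_subset (h5.trans (Set.image_mono fun x hx => ?_))
        (k5.trans (Set.image_mono fun x hx => ?_))⟩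
    · by_cases hx' : h x = 0
      · exact k4 x fun hk => hx (by rw [Pi.add_apply, hx', hk, add_zero])
      · exact h4 x hx'
    · exact add_pos_of_pos_of_nonneg hx (k3 x)
    · exact add_pos_of_nonneg_of_pos (h3 x) hx
  · rintro u hu
    obtain ⟨x, rfl⟩ := Quotient.exists_rep u
    have hxi : I.IsInteriorPoint x :=
      (I.isInteriorPoint_or_isBoundaryPoint x).resolve_right fun hb => hUb hu ⟨x, hb, rfl⟩
    obtain ⟨Φ, hΦ⟩ := exists_partialDiffeomorph_of_isInteriorPoint hxi
    obtain ⟨f, -, hf⟩ :=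
      (SmoothBumpFunction.nhds_basis_tsupport (I := I) x).mem_iff.1 (Φ.open_source.mem_nhds hΦ)
    have hpos : IsOpen {y | 0 < f y} := isOpen_lt continuous_const f.continuous
    refine ⟨𝒴.pt '' {y | 0 < f y}, mem_nhdsWithin_of_mem_nhds
      ((𝒴.isOpenMap_pt _ hpos).mem_nhds ⟨x, ?_, rfl⟩), f, f.contMDiff, f.hasCompactSupport,
      fun _ => f.nonneg, fun y hy => ⟨Φ, hf (subset_tsupport _ hy)⟩, subset_rfl⟩
    rw [Set.mem_ofPred_eq, f.eq_one]
    exact one_pos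

end Bump

/-! ### The double of an orbifold -/

section Double

variable {E : Type v} [NormedAddCommGroup E] [NormedSpace ℝ E] [FiniteDimensional ℝ E]
  {H : Type w} [TopologicalSpace H] {I : ModelWithCorners ℝ E H} (𝒴 : Orbifold.{u} I)
  (D : RegularLevel I 𝒴.Obj) (hD : ∀ g, D.fn (𝒴.src g) = D.fn (𝒴.tgt g))

/-- The level data on arrows, pulled back along the source map. -/
def arrLevel : RegularLevel I 𝒴.Arr := D.pullback 𝒴.src_localDiffeo

/-- The double of an orbifold along a regular level of an invariant function. -/
noncomputable def double : Orbifold.{u} 𝓘(ℝ, E) where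
  Obj := D.Double
  Arr := (𝒴.arrLevel D).Double
  src := RegularLevel.Double.map 𝒴.src (fun _ => rfl) rfl
  tgt := RegularLevel.Double.map 𝒴.tgt (fun g => (hD g).symm) rfl
  unit := RegularLevel.Double.map 𝒴.unit (fun x => congrArg D.fn (𝒴.src_unit x)) rfl
  inv := RegularLevel.Double.map 𝒴.inv
    (fun g => (congrArg D.fn (𝒴.src_inv g)).trans (hD g).symm) rfl
  comp g h p := RegularLevel.Double.mk
    (𝒴.comp g.base h.base (congrArg RegularLevel.Double.base p), g.height)
    ((congrArg (fun y => D.fn y - g.height ^ 2) (𝒴.src_comp _ _ _)).trans g.eq_level)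
  src_unit x := RegularLevel.Double.ext (𝒴.src_unit _) rfl
  tgt_unit x := RegularLevel.Double.ext (𝒴.tgt_unit _) rfl
  src_inv g := RegularLevel.Double.ext (𝒴.src_inv _) rfl
  tgt_inv g := RegularLevel.Double.ext (𝒴.tgt_inv _) rfl
  src_comp g h p := RegularLevel.Double.ext (𝒴.src_comp _ _ _) rfl
  tgt_comp g h p := RegularLevel.Double.ext (𝒴.tgt_comp _ _ _)
    (by
      have q := congrArg (RegularLevel.Double.height (D := D)) p
      exact q)
  unit_comp g := RegularLevel.Double.ext (𝒴.unit_comp _) rfl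
  comp_unit g := RegularLevel.Double.ext (𝒴.comp_unit _) rfl
  comp_inv g := RegularLevel.Double.ext (𝒴.comp_inv _) rfl
  inv_comp g := RegularLevel.Double.ext (𝒴.inv_comp _) rfl
  assoc g h k p q := RegularLevel.Double.ext (𝒴.assoc _ _ _ _ _) rfl
  src_localDiffeo := RegularLevel.Double.isLocalDiffeomorph_map 𝒴.src_localDiffeo
  tgt_localDiffeo := RegularLevel.Double.isLocalDiffeomorph_map 𝒴.tgt_localDiffeo
  unit_smooth := RegularLevel.Double.contMDiff_map 𝒴.unit_smooth
  inv_smooth := RegularLevel.Double.contMDiff_map 𝒴.inv_smooth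
  comp_continuous := by
    refine Continuous.subtype_mk (Continuous.prodMk ?_ ?_) _
    · refine 𝒴.comp_continuous.comp (f := fun p : {p : (𝒴.arrLevel D).Double ×
        (𝒴.arrLevel D).Double // RegularLevel.Double.map (D' := D) 𝒴.tgt (fun g => (hD g).symm)
          rfl p.1 = RegularLevel.Double.map (D' := D) 𝒴.src (fun _ => rfl) rfl p.2} =>
        (⟨(p.1.1.base, p.1.2.base), congrArg RegularLevel.Double.base p.2⟩ :
          {p : 𝒴.Arr × 𝒴.Arr // 𝒴.tgt p.1 = 𝒴.src p.2})) ?_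
      exact Continuous.subtype_mk
        ((RegularLevel.Double.continuous_base.comp (continuous_fst.comp continuous_subtype_val)
          ).prodMk (RegularLevel.Double.continuous_base.comp
            (continuous_snd.comp continuous_subtype_val))) _
    · exact RegularLevel.Double.continuous_height.comp (continuous_fst.comp continuous_subtype_val)
  proper := by
    have hs : Continuous (RegularLevel.Double.map (D := 𝒴.arrLevel D) (D' := D) 𝒴.src
        (fun _ => rfl) rfl) :=
      (RegularLevel.Double.contMDiff_map 𝒴.src_localDiffeo.contMDiff).continuous
    have ht : Continuous (RegularLevel.Double.map (D := 𝒴.arrLevel D) (D' := D) 𝒴.tgt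
        (fun g => (hD g).symm) rfl) :=
      (RegularLevel.Double.contMDiff_map 𝒴.tgt_localDiffeo.contMDiff).continuous
    rw [isProperMap_iff_ultrafilter]
    refine ⟨hs.prodMk ht, ?_⟩
    rintro F ⟨x, y⟩ hF
    have hF1 := (continuous_fst.tendsto (x, y)).comp hF
    have hF2 := (continuous_snd.tendsto (x, y)).comp hF
    have hh : Filter.Tendsto RegularLevel.Double.height (F : Filter (𝒴.arrLevel D).Double)
        (𝓝 x.height) := (RegularLevel.Double.continuous_height.tendsto x).comp hF1
    have hh2 : Filter.Tendsto RegularLevel.Double.height (F : Filter (𝒴.arrLevel D).Double)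
        (𝓝 y.height) := (RegularLevel.Double.continuous_height.tendsto y).comp hF2
    -- Source and target of an arrow have equal heights, so the two limits of heights coincide.
    have hxy : x.height = y.height := tendsto_nhds_unique hh hh2
    have hF' : Filter.Tendsto (fun g : 𝒴.Arr => (𝒴.src g, 𝒴.tgt g))
        (F.map RegularLevel.Double.base) (𝓝 (x.base, y.base)) := by
      rw [nhds_prod_eq]
      exact ((RegularLevel.Double.continuous_base.tendsto x).comp hF1).prodMk
        ((RegularLevel.Double.continuous_base.tendsto y).comp hF2)
    obtain ⟨g, hg, hFg⟩ := (isProperMap_iff_ultrafilter.1 𝒴.proper).2 hF'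
    have hgs : 𝒴.src g = x.base := congrArg Prod.fst hg
    have hgt : 𝒴.tgt g = y.base := congrArg Prod.snd hg
    refine ⟨RegularLevel.Double.mk (g, x.height) ?_, ?_, ?_⟩
    · change D.fn (𝒴.src g) - x.height ^ 2 = D.level
      rw [hgs]; exact x.eq_level
    · exact Prod.ext (RegularLevel.Double.ext hgs rfl) (RegularLevel.Double.ext hgt hxy)
    · exact RegularLevel.Double.tendsto_nhds_of_coord (h := id) hFg hh

theorem isClosedOrbifold_double {K : Set 𝒴.Obj} (hK : IsCompact K)
    (hKD : ∀ x, D.level ≤ D.fn x → ∃ g, 𝒴.src g = x ∧ 𝒴.tgt g ∈ K) :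
    (𝒴.double D hD).IsClosedOrbifold := by
  refine ⟨⟨?_⟩, ?_⟩
  -- With `B` a bound for the level function on `K`, points over `K` satisfy `t² ≤ B - level`. Every
  -- orbit of the double meets this compact piece.
  · obtain ⟨B, hB⟩ := (hK.image D.smooth.continuous).bddAbove
    have hC : IsCompact ((fun z : D.Double => (z.base, z.height)) ⁻¹'
        (K ×ˢ Set.Icc (-√(B - D.level)) (√(B - D.level)))) :=
      RegularLevel.Double.isClosedEmbedding_coord.isCompact_preimage (hK.prod isCompact_Icc)
    have himg := hC.image (𝒴.double D hD).continuous_pt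
    convert himg
    symm
    rw [Set.eq_univ_iff_forall]
    intro p
    obtain ⟨z, rfl⟩ := Quotient.exists_rep p
    obtain ⟨g, hg, hgK⟩ := hKD (RegularLevel.Double.base z) (by
      have := RegularLevel.Double.eq_level (D := D) z
      nlinarith [sq_nonneg (RegularLevel.Double.height (D := D) z)])
    have hz := RegularLevel.Double.eq_level (D := D) z
    have hlev : D.fn (𝒴.src g) - (RegularLevel.Double.height (D := D) z) ^ 2 = D.level := by
      rw [hg]; exact hz
    let k : (𝒴.arrLevel D).Double :=
      RegularLevel.Double.mk (g, RegularLevel.Double.height (D := D) z) hlev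
    refine ⟨(𝒴.double D hD).tgt k, ⟨hgK, abs_le.1 ?_⟩, ?_⟩
    · change |RegularLevel.Double.height (D := D) z| ≤ _
      rw [← Real.sqrt_sq_eq_abs]
      refine Real.sqrt_le_sqrt ?_
      have h1 := hB ⟨_, hgK, rfl⟩
      rw [← hD g] at h1
      linarith
    · refine ((𝒴.double D hD).pt_src k).symm.trans (congrArg (𝒴.double D hD).pt ?_)
      exact RegularLevel.Double.ext hg rfl
  · rw [boundary, ModelWithCorners.Boundaryless.boundary_eq_empty, Set.image_empty]

/-- The open superlevel set embeds in the double. -/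
noncomputable def openEmbeddingDouble (V : TopologicalSpace.Opens 𝒴.Space)
    (hV : ∀ x, 𝒴.pt x ∈ V ↔ D.level < D.fn x) :
    (𝒴.restrict V).OpenEmbedding (𝒴.double D hD) where
  obj := RegularLevel.Double.upper (𝒴.objOver V) fun x hx => (hV x).1 hx
  arr := RegularLevel.Double.upper (D := 𝒴.arrLevel D) (𝒴.arrOver V) fun g hg => (hV (𝒴.src g)).1 hg
  src_arr g := rfl
  tgt_arr g := RegularLevel.Double.ext rfl
    (congrArg (fun r => √(r - D.level)) (hD g.1))
  arr_unit x := RegularLevel.Double.ext rfl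
    (congrArg (fun y => √(D.fn y - D.level)) (𝒴.src_unit x.1))
  arr_comp g h p := RegularLevel.Double.ext rfl
    (congrArg (fun y => √(D.fn y - D.level)) (𝒴.src_comp g.1 h.1 _))
  obj_localDiffeo := RegularLevel.Double.isLocalDiffeomorph_upper fun x hx => (hV x).2 hx
  arr_smooth := RegularLevel.Double.contMDiff_upper
  fullyFaithful x y k hx hy := by
    have hb : 𝒴.src (RegularLevel.Double.base (D := 𝒴.arrLevel D) k) = x.1 :=
      congrArg RegularLevel.Double.base hx
    have hb' : 𝒴.tgt (RegularLevel.Double.base (D := 𝒴.arrLevel D) k) = y.1 :=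
      congrArg RegularLevel.Double.base hy
    -- The source condition forces the height of `k` to be the positive root, so `k` is determined
    -- by its underlying arrow.
    have hh : RegularLevel.Double.height (D := 𝒴.arrLevel D) k = √(D.fn x.1 - D.level) :=
      congrArg RegularLevel.Double.height hx
    have hmem : RegularLevel.Double.base (D := 𝒴.arrLevel D) k ∈ 𝒴.arrOver V := by
      change 𝒴.src _ ∈ 𝒴.objOver V
      rw [hb]; exact x.2
    refine ⟨⟨_, hmem⟩, ⟨Subtype.ext hb, Subtype.ext hb', RegularLevel.Double.ext rfl ?_⟩, ?_⟩
    · refine Eq.trans ?_ hh.symm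
      exact congrArg (fun y => √(D.fn y - D.level)) hb
    · rintro g ⟨-, -, hg⟩
      exact Subtype.ext (congrArg RegularLevel.Double.base hg)

end Double

end Orbifold

/-! ### The embedding into a closed orbifold -/

theorem proposition2p1 {E : Type v} [NormedAddCommGroup E] [NormedSpace ℝ E]
    [FiniteDimensional ℝ E] {H : Type w} [TopologicalSpace H] (I : ModelWithCorners ℝ E H)
    (𝒴 : Orbifold.{u} I) (_γ : 𝒴.RiemannianMetric)
    (U : Set 𝒴.Space) (hU : IsCompact U) (hUb : U ⊆ 𝒴.boundaryᶜ) :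
    ∃ (V : TopologicalSpace.Opens 𝒴.Space) (𝒲 : Orbifold.{u} 𝓘(ℝ, E)),
      U ⊆ V ∧ 𝒲.IsClosedOrbifold ∧ Nonempty ((𝒴.restrict V).OpenEmbedding 𝒲) := by
  obtain ⟨h, hs, hc, h0, hchart, hpos⟩ := 𝒴.exists_compactlySupported_pos hU hUb
  let ρ := 𝒴.orbitSum h
  have hρ : ContMDiff I 𝓘(ℝ, ℝ) ∞ ρ := Orbifold.contMDiff_orbitSum hs hc
  let ρq : 𝒴.Space → ℝ := Quotient.lift ρ fun x y hxy =>
    Orbifold.orbitSum_eq_of_pt_eq h (Quotient.sound hxy)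
  have hρq : Continuous ρq := hρ.continuous.quotient_lift _
  have hρpos : ∀ p ∈ U, 0 < ρq p := by
    intro p hp
    obtain ⟨x, rfl⟩ := Quotient.exists_rep p
    obtain ⟨g, rfl, hg⟩ := hpos x hp
    exact Orbifold.orbitSum_pos hc h0 hg
  obtain ⟨δ, hδ, hδU⟩ : ∃ δ > 0, ∀ p ∈ U, δ ≤ ρq p := by
    rcases U.eq_empty_or_nonempty with rfl | hne
    -- The empty set has no minimum; any positive `δ` will do.
    · exact ⟨1, one_pos, fun p hp => hp.elim⟩
    · obtain ⟨p, hp, hmin⟩ := hU.exists_isMinOn hne hρq.continuousOn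
      exact ⟨ρq p, hρpos p hp, fun q hq => hmin hq⟩
  -- The interval has positive length, so it cannot consist of critical values.
  obtain ⟨c, hcδ, hcrit⟩ := Set.not_subset.1 fun hsub : Set.Ioo 0 δ ⊆ _ => by
    have := MeasureTheory.measure_mono_null hsub (volume_critical_values hρ)
    rw [Real.volume_Ioo, ENNReal.ofReal_eq_zero] at this
    linarith
  have hex : ∀ x, c ≤ ρ x → ∃ g, 𝒴.src g = x ∧ h (𝒴.tgt g) ≠ 0 := fun x hx =>
    Orbifold.exists_arrow_of_orbitSum_pos (hcδ.1.trans_le hx)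
  have hchart' : ∀ x, c ≤ ρ x → ∃ Φ : PartialDiffeomorph I 𝓘(ℝ, E) 𝒴.Obj E ∞, x ∈ Φ.source := by
    intro x hx
    obtain ⟨g, rfl, hg⟩ := hex x hx
    -- The chart at `tgt g` is carried back to `src g` by the local diffeomorphism that the arrow
    -- `g` induces.
    obtain ⟨Φ, hΦ⟩ := hchart _ hg
    obtain ⟨S, hgS, hS⟩ := 𝒴.src_localDiffeo g
    obtain ⟨T, hgT, hT⟩ := 𝒴.tgt_localDiffeo g
    have hSg : S.symm (𝒴.src g) = g := by
      rw [hS hgS]; exact S.toPartialEquiv.left_inv hgS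
    refine ⟨S.symm.trans (T.trans Φ), ?_, ?_, ?_⟩
    · rw [hS hgS]; exact S.toPartialEquiv.map_source hgS
    · change S.symm (𝒴.src g) ∈ T.source
      rwa [hSg]
    · change T (S.symm (𝒴.src g)) ∈ Φ.source
      rwa [hSg, ← hT hgT]
  let D : RegularLevel I 𝒴.Obj :=
    { fn := ρ
      level := c
      smooth := hρ
      exists_chart := hchart'
      regular := fun x hx => by
        by_contra! hcon
        exact hcrit ⟨x, ⟨hchart' x hx.ge, hcon⟩, hx⟩ }
  have hD : ∀ g, D.fn (𝒴.src g) = D.fn (𝒴.tgt g) := Orbifold.orbitSum_src_eq h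
  let V : TopologicalSpace.Opens 𝒴.Space := ⟨{p | c < ρq p}, isOpen_lt continuous_const hρq⟩
  refine ⟨V, 𝒴.double D hD, fun p hp => hcδ.2.trans_le (hδU p hp),
    𝒴.isClosedOrbifold_double D hD hc fun x hx => ?_,
    ⟨𝒴.openEmbeddingDouble D hD V fun x => Iff.rfl⟩⟩
  obtain ⟨g, hg, hg'⟩ := hex x hx
  exact ⟨g, hg, subset_tsupport _ hg'⟩
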